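/- **Theorem 2.2.** A *Young function* is a continuous, convex, even function $\Phi:\mathbb R\to\mathbb R$ with $\Phi(x)=0$ iff $x=0$, $\lim_{x\to\infty}\Phi(x)/x=\infty$ and $\lim_{x\to\infty}\Phi(x)=\infty$. Its complementary function is $\Phi^*(y)=\sup\{x|y|-\Phi(x):x\ge 0\}$. For $t\in[0,\infty]$ put $\Phi^{-1}(t)=\sup\{x\ge 0:\Phi(x)\le t\}\in[0,\infty]$, and define $\Phi^{*-1}$ in the same way; this is the usual inverse where the function is strictly increasing on $[0,\infty)$. Write $\Phi\preceq\Psi$ if there are $a,x_0\ge 0$ with $\Phi(x)\le\Psi(ax)$ for all $x\ge x_0$; *globally* means that one can take $x_0=0$. Write $\Psi\in\Delta'$ globally if for some $c>0$, $\Psi(xy)\le c\,\Psi(x)\Psi(y)$ for all $x,y\ge 0$. Let $(\Omega,\Sigma,\mu)$ be a $\sigma$-finite measure space, let $\mathcal A\subseteq\Sigma$ be a $\sigma$-subalgebra such that $(\Omega,\mathcal A,\mu|_{\mathcal A})$ is $\sigma$-finite, and let $E$ be the conditional expectation with respect to $\mathcal A$. It is defined for all $[0,\infty]$-valued measurable functions,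 and for *conditionable* complex measurable functions $f$, i.e. those with $E(|f|)<\infty$ a.e., by $E(f)=E(\operatorname{Re}f)+iE(\operatorname{Im}f)$ with $E(h)=E(h^+)-E(h^-)$ for real $h$. Let $\Phi,\Psi$ be Young functions. Let $L^\Phi(\Sigma)$ be the Orlicz space of measurable $f:\Omega\to\mathbb C$ with $\int_\Omega\Phi(k|f|)\,d\mu<\infty$ for some $k>0$, with norm $N_\Phi(f)=\inf\{k>0:\int_\Omega\Phi(|f|/k)\,d\mu\le 1\}$. For measurable $u:\Omega\to\mathbb C$ let $R_uf=E(uf)$. We say that $R_u$ is *bounded from $L^\Phi(\Sigma)$ into $L^\Psi(\Sigma)$* if it is well defined, i.e. $uf$ is conditionable and $E(uf)\in L^\Psi(\Sigma)$ for every $f\in L^\Phi(\Sigma)$, and there is $K<\infty$ with $N_\Psi(R_uf)\le K N_\Phi(f)$ for all $f\in L^\Phi(\Sigma)$; $\|R_u\|$ is the least such $K$. Write $\Psi^*(u)=\Psi^*(|u|)$. The pair $(E,\Psi)$ *satisfies the GCH-inequality with constant $C>0$* if for all $f\in L^\Psi(\Sigma)$ and $g\in L^{\Psi^*}(\Sigma)$,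 a.e. on $\Omega$, $$E(|fg|)\le C\,\Psi^{-1}\big(E(\Psi(|f|))\big)\,\Psi^{*-1}\big(E(\Psi^*(|g|))\big)$$ (with $0\cdot\infty=0$); it *satisfies the GCH-inequality* if it does so with some constant $C>0$. (a) Assume $\Phi\preceq\Psi$ if $\mu(\Omega)<\infty$, respectively $\Phi\preceq\Psi$ globally if $\mu(\Omega)=\infty$, and that $R_u$ is bounded from $L^\Phi(\Sigma)$ into $L^\Psi(\Sigma)$. (i) Then $u$ is conditionable and $E(u)\in L^\infty(\mathcal A)$. (ii) If moreover $\Psi\in\Delta'$ globally and $\Psi^*$ is again a Young function, then $\Psi^{*-1}(E(\Psi^*(u)))\in L^\infty(\mathcal A)$. (b) Assume $\Psi\preceq\Phi$ if $\mu(\Omega)<\infty$, respectively $\Psi\preceq\Phi$ globally if $\mu(\Omega)=\infty$, that $(E,\Psi)$ satisfies the GCH-inequality and that $\Psi^{*-1}(E(\Psi^*(u)))\in L^\infty(\mathcal A)$. Then $R_u$ is bounded from $L^\Phi(\Sigma)$ into $L^\Psi(\Sigma)$. Moreover, for every constant $C>0$ with which $(E,\Psi)$ satisfies the GCH-inequality: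 * if $\mu(\Omega)=\infty$ and $a\ge 0$ is such that $\Psi(x)\le\Phi(ax)$ for all $x\ge 0$, then $$\|R_u\|\le a\,C\,\big\|\Psi^{*-1}(E(\Psi^*(u)))\big\|_\infty ;$$ * if $\mu(\Omega)<\infty$ and $a,T\ge 0$ are such that $\Psi(x)\le\Phi(ax)$ for all $x\ge T$, then $$\|R_u\|\le a\,C\,(N+1)\,\big\|\Psi^{*-1}(E(\Psi^*(u)))\big\|_\infty,\qquad N=\Psi(T)\,\mu(\Omega).$$ -/

import Mathlib

open MeasureTheory Filter
open scoped ENNReal NNReal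

noncomputable section

/-! ### Young functions -/

/-- A Young function: a continuous, convex, even function `Φ : ℝ → ℝ` that vanishes exactly
at `0` and satisfies `Φ x / x → ∞` and `Φ x → ∞` as `x → ∞`. -/
structure IsYoungFunction (Φ : ℝ → ℝ) : Prop where
  continuous : Continuous Φ
  convexOn : ConvexOn ℝ Set.univ Φ
  eq_zero_iff : ∀ x, Φ x = 0 ↔ x = 0
  even : ∀ x, Φ (-x) = Φ x
  tendsto_div : Tendsto (fun x => Φ x / x) atTop atTop
  tendsto_atTop : Tendsto Φ atTop atTop

/-- The complementary function `Φ* y = sup {x |y| - Φ x : x ≥ 0}`. For a Young function the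
supremum is over a nonempty set that is bounded above. -/
def youngCompl (Φ : ℝ → ℝ) (y : ℝ) : ℝ :=
  sSup {z : ℝ | ∃ x : ℝ, 0 ≤ x ∧ z = x * |y| - Φ x}

/-- The inverse of the restriction of `Φ` to `[0, ∞]`, as a map `[0, ∞] → [0, ∞]`:
`Φ⁻¹ t = sup {x ≥ 0 : Φ x ≤ t}`. If `Φ` is continuous and strictly increasing on `[0, ∞)` with
`Φ 0 = 0` and `Φ x → ∞`, this is the genuine inverse function, with value `∞` at `∞`. -/
def youngInv (Φ : ℝ → ℝ) (t : ℝ≥0∞) : ℝ≥0∞ :=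
  ⨆ (x : ℝ≥0) (_ : ENNReal.ofReal (Φ x) ≤ t), (x : ℝ≥0∞)

/-- `Φ x ≤ Ψ (a x)` for all `x ≥ x₀`. -/
def YoungDomWith (Φ Ψ : ℝ → ℝ) (a x₀ : ℝ) : Prop :=
  0 ≤ a ∧ 0 ≤ x₀ ∧ ∀ x, x₀ ≤ x → Φ x ≤ Ψ (a * x)

/-- `Φ ⪯ Ψ`. -/
def YoungDom (Φ Ψ : ℝ → ℝ) : Prop := ∃ a x₀, YoungDomWith Φ Ψ a x₀

/-- `Φ ⪯ Ψ` globally. -/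
def YoungDomGlobally (Φ Ψ : ℝ → ℝ) : Prop := ∃ a, YoungDomWith Φ Ψ a 0

/-- The `Δ'` condition, globally: `Φ (x y) ≤ c Φ x Φ y` for all `x, y ≥ 0`. -/
def DeltaPrimeGlobally (Φ : ℝ → ℝ) : Prop :=
  ∃ c : ℝ, 0 < c ∧ ∀ x y, 0 ≤ x → 0 ≤ y → Φ (x * y) ≤ c * Φ x * Φ y

variable {Ω : Type*}

/-- The comparison `Φ ⪯ Ψ` appropriate to the total mass: `Φ ⪯ Ψ` when `μ Ω < ∞`, and
`Φ ⪯ Ψ` globally when `μ Ω = ∞`. -/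
def YoungDomFor {mΩ : MeasurableSpace Ω} (μ : Measure[mΩ] Ω) (Φ Ψ : ℝ → ℝ) : Prop :=
  (μ Set.univ < ∞ ∧ YoungDom Φ Ψ) ∨ (μ Set.univ = ∞ ∧ YoungDomGlobally Φ Ψ)

/-! ### Orlicz spaces -/

/-- Membership in the Orlicz space `L^Φ(Σ)`. -/
def MemOrlicz {mΩ : MeasurableSpace Ω} (Φ : ℝ → ℝ) (μ : Measure[mΩ] Ω) (f : Ω → ℂ) : Prop :=
  Measurable[mΩ] f ∧ ∃ k : ℝ, 0 < k ∧ ∫⁻ x, ENNReal.ofReal (Φ (k * ‖f x‖)) ∂μ < ∞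

/-- The Luxemburg norm `N_Φ(f) = inf {k > 0 : ∫ Φ(|f| / k) dμ ≤ 1}`, with value `∞` if there is
no such `k`. -/
def luxemburgNorm {mΩ : MeasurableSpace Ω} (Φ : ℝ → ℝ) (μ : Measure[mΩ] Ω) (f : Ω → ℂ) :
    ℝ≥0∞ :=
  ⨅ (k : ℝ) (_ : 0 < k) (_ : ∫⁻ x, ENNReal.ofReal (Φ (‖f x‖ / k)) ∂μ ≤ 1), ENNReal.ofReal k

/-! ### Conditional expectation -/

/-- `E(Φ(|f|))`, the conditional expectation of a nonnegative function, with values in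
`[0, ∞]`. -/
def condYoung (𝒜 : MeasurableSpace Ω) {mΩ : MeasurableSpace Ω} (μ : Measure[mΩ] Ω)
    (Φ : ℝ → ℝ) (f : Ω → ℂ) : Ω → ℝ≥0∞ :=
  condLExp 𝒜 μ (fun x => ENNReal.ofReal (Φ ‖f x‖))

/-- A complex function is conditionable with respect to `𝒜` if `E(|f|) < ∞` almost
everywhere. No integrability of `f` over `Ω` is required. -/
def Conditionable (𝒜 : MeasurableSpace Ω) {mΩ : MeasurableSpace Ω} (μ : Measure[mΩ] Ω)
    (f : Ω → ℂ) : Prop :=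
  Measurable[mΩ] f ∧ ∀ᵐ x ∂μ, condLExp 𝒜 μ (fun x => ‖f x‖ₑ) x < ∞

/-- The conditional expectation of a real function,
`E(f) = E(f⁺) - E(f⁻)`. -/
def condExpReal (𝒜 : MeasurableSpace Ω) {mΩ : MeasurableSpace Ω} (μ : Measure[mΩ] Ω)
    (f : Ω → ℝ) (x : Ω) : ℝ :=
  (condLExp 𝒜 μ (fun y => ENNReal.ofReal (f y)) x).toReal
    - (condLExp 𝒜 μ (fun y => ENNReal.ofReal (-f y)) x).toReal

/-- The conditional expectation of a (conditionable) complex function,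
`E(f) = E(Re f) + i E(Im f)`. -/
def condExpComplex (𝒜 : MeasurableSpace Ω) {mΩ : MeasurableSpace Ω} (μ : Measure[mΩ] Ω)
    (f : Ω → ℂ) (x : Ω) : ℂ :=
  ⟨condExpReal 𝒜 μ (fun y => (f y).re) x, condExpReal 𝒜 μ (fun y => (f y).im) x⟩

/-- The generalized conditional-type Hölder inequality for `(E, Φ)` with constant `C`. -/
def GCHWith (𝒜 : MeasurableSpace Ω) {mΩ : MeasurableSpace Ω} (μ : Measure[mΩ] Ω)
    (Φ : ℝ → ℝ) (C : ℝ) : Prop :=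
  ∀ f g : Ω → ℂ, MemOrlicz Φ μ f → MemOrlicz (youngCompl Φ) μ g →
    ∀ᵐ x ∂μ, condLExp 𝒜 μ (fun y => ‖f y * g y‖ₑ) x ≤
      ENNReal.ofReal C * youngInv Φ (condYoung 𝒜 μ Φ f x)
        * youngInv (youngCompl Φ) (condYoung 𝒜 μ (youngCompl Φ) g x)

/-- `(E, Φ)` satisfies the generalized conditional-type Hölder inequality. -/
def GCH (𝒜 : MeasurableSpace Ω) {mΩ : MeasurableSpace Ω} (μ : Measure[mΩ] Ω)
    (Φ : ℝ → ℝ) : Prop :=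
  ∃ C : ℝ, 0 < C ∧ GCHWith 𝒜 μ Φ C

/-! ### Weighted conditional type operators -/

/-- The weighted conditional type operator `R_u f = E(u f)`. -/
def wct (𝒜 : MeasurableSpace Ω) {mΩ : MeasurableSpace Ω} (μ : Measure[mΩ] Ω)
    (u f : Ω → ℂ) : Ω → ℂ :=
  condExpComplex 𝒜 μ (fun x => u x * f x)

/-- `R_u` is well defined as an operator from `L^Φ(Σ)` into `L^Ψ(Σ)`: for every `f ∈ L^Φ(Σ)`,
`u f` is conditionable and `E(u f) ∈ L^Ψ(Σ)`. -/
def WCTWellDefined (𝒜 : MeasurableSpace Ω) {mΩ : MeasurableSpace Ω} (μ : Measure[mΩ] Ω)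
    (Φ Ψ : ℝ → ℝ) (u : Ω → ℂ) : Prop :=
  ∀ f, MemOrlicz Φ μ f →
    Conditionable 𝒜 μ (fun x => u x * f x) ∧ MemOrlicz Ψ μ (wct 𝒜 μ u f)

/-- `R_u` is a bounded operator from `L^Φ(Σ)` into `L^Ψ(Σ)`. -/
def WCTBounded (𝒜 : MeasurableSpace Ω) {mΩ : MeasurableSpace Ω} (μ : Measure[mΩ] Ω)
    (Φ Ψ : ℝ → ℝ) (u : Ω → ℂ) : Prop :=
  WCTWellDefined 𝒜 μ Φ Ψ u ∧
    ∃ K : ℝ≥0, ∀ f, MemOrlicz Φ μ f →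
      luxemburgNorm Ψ μ (wct 𝒜 μ u f) ≤ K * luxemburgNorm Φ μ f

/-- The operator norm of `R_u : L^Φ(Σ) → L^Ψ(Σ)`. -/
def wctOpNorm (𝒜 : MeasurableSpace Ω) {mΩ : MeasurableSpace Ω} (μ : Measure[mΩ] Ω)
    (Φ Ψ : ℝ → ℝ) (u : Ω → ℂ) : ℝ≥0∞ :=
  sInf {K : ℝ≥0∞ | ∀ f, MemOrlicz Φ μ f →
    luxemburgNorm Ψ μ (wct 𝒜 μ u f) ≤ K * luxemburgNorm Φ μ f}

/-- The function `Ψ*⁻¹(E(Ψ*(u)))`. -/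
def wctSymbol (𝒜 : MeasurableSpace Ω) {mΩ : MeasurableSpace Ω} (μ : Measure[mΩ] Ω)
    (Ψ : ℝ → ℝ) (u : Ω → ℂ) (x : Ω) : ℝ≥0∞ :=
  youngInv (youngCompl Ψ) (condYoung 𝒜 μ (youngCompl Ψ) u x)

end

/-! Domination of Young functions yields a continuous inclusion of Orlicz spaces
(`YoungDomWith.luxemburgNorm_le`): if `Φ x ≤ Ψ (a x)` for `x ≥ T`, the modular for `Φ` exceeds the one
for `Ψ` by at most `N = Φ(T) μ(Ω)`, and convexity turns this into the factor `a (N + 1)` between the norms. For infinite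
measure `T = 0` and `N = 0 * ∞ = 0`, so that both cases of the theorem are treated at once.

For the necessary conditions, `R_u` is tested on functions `f` with `N_Ψ(f) ≤ N_Ψ(χ_A)` for an
`𝒜`-measurable set `A` of finite measure. If `|R_u f| ≥ l` on `A`, then boundedness gives
`l N_Ψ(χ_A) ≤ K B N_Ψ(χ_A)`, where `B` bounds the norm of the inclusion `L^Ψ ⊆ L^Φ`; hence `A` is null
when `l > K B` (`measure_eq_zero_of_le_norm_wct`). With `f = χ_A` this bounds `E(u)`. For the second
condition let `v = Ψ*(|u|)`, cut off where `|u|` is large, and `h = E(v)`. The quotient `v / |u|`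
satisfies `Ψ(v / |u|) ≤ v` (`IsYoungFunction.map_youngCompl_div_le`), so for `𝒜`-measurable `φ ≥ 0`
the function `f = conj(sgn u) (v / |u|) φ` has `R_u f = φ h`, and by `Δ'` its modulars are at most
`c² ∫ Ψ(t) Ψ(φ) h`. The choice `φ = w r / h` with `c² r Ψ(w) = 1` makes `R_u f` the constant `w r`
where `h ≥ r`, with `f` no larger in norm than the indicator of that set. Since `Ψ*` vanishes only
at `0`, `Ψ(w) / w` can be made arbitrarily small, so `w r = w / (c² Ψ(w))` can be made larger than
`K B`. Hence `h < r` almost everywhere, with `r` independent of the cut-off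
(`condLExp_cutoff_lt`), and `E(Ψ*(|u|)) ≤ r` by monotone convergence.

For the sufficient condition, the `GCH`-inequality applied to `f / k` and to restrictions of `u` to
sets of finite measure gives `|E(u f)| ≤ E(|u f|) ≤ k C S Ψ⁻¹(E(Ψ(|f| / k)))`, with `S` the
supremum of the symbol; applying `Ψ` and integrating yields `N_Ψ(R_u f) ≤ C S N_Ψ(f)`
(`GCHWith.luxemburgNorm_wct_le`). -/

/-! ### Young functions and their complementary functions -/

namespace IsYoungFunction

variable {Φ Ψ : ℝ → ℝ}

theorem map_zero (hΦ : IsYoungFunction Φ) : Φ 0 = 0 := (hΦ.eq_zero_iff 0).2 rfl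

theorem nonneg (hΦ : IsYoungFunction Φ) (x : ℝ) : 0 ≤ Φ x := by
  have h := hΦ.convexOn.2 (Set.mem_univ x) (Set.mem_univ (-x)) (one_half_pos (α := ℝ)).le
    one_half_pos.le (add_halves 1)
  simp only [smul_eq_mul, hΦ.even x] at h
  have h0 : 1 / 2 * x + 1 / 2 * -x = 0 := by ring
  rw [h0, hΦ.map_zero] at h
  linarith

theorem pos (hΦ : IsYoungFunction Φ) {x : ℝ} (hx : x ≠ 0) : 0 < Φ x :=
  (hΦ.nonneg x).lt_of_ne fun h => hx ((hΦ.eq_zero_iff x).1 h.symm)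

theorem map_mul_le (hΦ : IsYoungFunction Φ) {s : ℝ} (x : ℝ) (hs0 : 0 ≤ s) (hs1 : s ≤ 1) :
    Φ (s * x) ≤ s * Φ x := by
  have h := hΦ.convexOn.2 (Set.mem_univ x) (Set.mem_univ 0) hs0 (sub_nonneg.2 hs1)
    (add_sub_cancel s 1)
  simpa [hΦ.map_zero] using h

theorem mono (hΦ : IsYoungFunction Φ) {x y : ℝ} (hx : 0 ≤ x) (hxy : x ≤ y) : Φ x ≤ Φ y := by
  rcases hx.eq_or_lt with rfl | hx
  · rw [hΦ.map_zero]; exact hΦ.nonneg y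
  have hy : 0 < y := hx.trans_le hxy
  have h := hΦ.map_mul_le y (div_nonneg hx.le hy.le) ((div_le_one hy).2 hxy)
  rw [div_mul_cancel₀ _ hy.ne'] at h
  exact h.trans (mul_le_of_le_one_left (hΦ.nonneg y) ((div_le_one hy).2 hxy))

theorem dom_pos (hΦ : IsYoungFunction Φ) (hΨ : IsYoungFunction Ψ) {a T : ℝ}
    (h : YoungDomWith Φ Ψ a T) : 0 < a := by
  refine h.1.lt_of_ne ?_
  rintro rfl
  have h1 := h.2.2 (T + 1) (by linarith)
  rw [zero_mul, hΨ.map_zero] at h1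
  exact absurd h1 (not_le.2 (hΦ.pos (by linarith [h.2.1])))

/-- The superlinear growth of `Ψ` makes its complementary function finite. -/
theorem bddAbove_youngCompl (hΨ : IsYoungFunction Ψ) (y : ℝ) :
    BddAbove {z : ℝ | ∃ x : ℝ, 0 ≤ x ∧ z = x * |y| - Ψ x} := by
  obtain ⟨X, hX⟩ := (hΨ.tendsto_div.eventually_ge_atTop |y|).exists_forall_of_atTop
  refine ⟨max X 1 * |y|, ?_⟩
  rintro z ⟨x, hx, rfl⟩
  rcases le_total x (max X 1) with h | h
  · nlinarith [hΨ.nonneg x, abs_nonneg y]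
  · have hx1 : 0 < x := lt_of_lt_of_le zero_lt_one ((le_max_right _ _).trans h)
    have h2 := hX x ((le_max_left _ _).trans h)
    rw [le_div_iff₀ hx1] at h2
    have h3 : 0 ≤ max X 1 * |y| :=
      mul_nonneg (zero_le_one.trans (le_max_right X 1)) (abs_nonneg y)
    linarith

/-- Young's inequality. -/
theorem mul_sub_le_youngCompl (hΨ : IsYoungFunction Ψ) {x : ℝ} (y : ℝ) (hx : 0 ≤ x) :
    x * |y| - Ψ x ≤ youngCompl Ψ y :=
  le_csSup (hΨ.bddAbove_youngCompl y) ⟨x, hx, rfl⟩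

theorem youngCompl_le {y M : ℝ} (h : ∀ x, 0 ≤ x → x * |y| - Ψ x ≤ M) : youngCompl Ψ y ≤ M := by
  refine csSup_le ⟨_, 0, le_rfl, rfl⟩ ?_
  rintro z ⟨x, hx, rfl⟩
  exact h x hx

theorem youngCompl_nonneg (hΨ : IsYoungFunction Ψ) (y : ℝ) : 0 ≤ youngCompl Ψ y := by
  simpa [hΨ.map_zero] using hΨ.mul_sub_le_youngCompl y le_rfl

theorem youngCompl_zero (hΨ : IsYoungFunction Ψ) : youngCompl Ψ 0 = 0 :=
  (youngCompl_le fun x _ => by simpa using hΨ.nonneg x).antisymm (hΨ.youngCompl_nonneg 0)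

theorem youngCompl_mono (hΨ : IsYoungFunction Ψ) {y z : ℝ} (h : |y| ≤ |z|) :
    youngCompl Ψ y ≤ youngCompl Ψ z :=
  youngCompl_le fun x hx => (hΨ.mul_sub_le_youngCompl z hx).trans'
    (by nlinarith [mul_le_mul_of_nonneg_left h hx])

theorem tendsto_youngCompl (hΨ : IsYoungFunction Ψ) : Tendsto (youngCompl Ψ) atTop atTop := by
  refine tendsto_atTop_mono (f := fun y => y + -Ψ 1) (fun y => ?_)
    (tendsto_atTop_add_const_right _ _ tendsto_id)
  have := hΨ.mul_sub_le_youngCompl y zero_le_one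
  linarith [le_abs_self y]

theorem measurable_youngCompl_norm (hΨ : IsYoungFunction Ψ) {Ω : Type*} {mΩ : MeasurableSpace Ω}
    {u : Ω → ℂ} (hu : Measurable u) : Measurable fun x => youngCompl Ψ ‖u x‖ := by
  have h : Monotone fun y : ℝ => youngCompl Ψ (max y 0) := fun y z hyz =>
    hΨ.youngCompl_mono (by
      rw [abs_of_nonneg (le_max_right _ _), abs_of_nonneg (le_max_right _ _)]
      exact max_le_max_right 0 hyz)
  have h2 := h.measurable.comp hu.norm
  simpa [Function.comp_def] using h2

/-- The quotient `Ψ* y / y` almost realises equality in Young's inequality: its product with `y`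
is `Ψ* y`, while `Ψ` of it does not exceed `Ψ* y`. -/
theorem map_youngCompl_div_le (hΨ : IsYoungFunction Ψ) {y : ℝ} (hy : 0 < y) :
    Ψ (youngCompl Ψ y / y) ≤ youngCompl Ψ y := by
  set z := youngCompl Ψ y / y with hz
  have hzy : youngCompl Ψ y = z * y := by rw [hz, div_mul_cancel₀ _ hy.ne']
  rcases (div_nonneg (hΨ.youngCompl_nonneg y) hy.le).eq_or_lt with h0 | h0
  · rw [← hz] at h0
    rw [← h0, hΨ.map_zero]; exact hΨ.youngCompl_nonneg y
  rw [← hz] at h0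
  by_contra! hlt
  rw [hzy] at hlt
  have hp : 0 < Ψ (z / 2) := hΨ.pos (by linarith)
  -- If `z y < Ψ z`, the supremum defining `Ψ* y` is smaller than `z y`: convexity controls the
  -- points beyond `z`, and `Ψ > 0` those below.
  have h1 : youngCompl Ψ y ≤ max (z * y / 2) (z * y - Ψ (z / 2)) := by
    refine youngCompl_le fun x hx => ?_
    rw [abs_of_pos hy]
    rcases le_total x (z / 2) with hxz | hxz
    · refine le_max_of_le_left ?_
      nlinarith [hΨ.nonneg x]
    rcases le_total x z with hxz' | hxz'
    · refine le_max_of_le_right ?_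
      nlinarith [hΨ.mono (by linarith) hxz]
    · refine le_max_of_le_left ?_
      have hx0 : 0 < x := h0.trans_le hxz'
      have h2 := hΨ.map_mul_le x (div_nonneg h0.le hx0.le) ((div_le_one hx0).2 hxz')
      rw [div_mul_cancel₀ _ hx0.ne', div_mul_eq_mul_div, le_div_iff₀ hx0] at h2
      have h3 : x * y ≤ Ψ x := by
        by_contra! h4
        nlinarith
      nlinarith [mul_pos h0 hy]
  rw [hzy] at h1
  rcases le_max_iff.1 h1 with h | h
  · nlinarith [mul_pos h0 hy]
  · linarith

/-- If `Ψ*` vanishes only at `0`, then `Ψ` is not bounded below by a linear function. -/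
theorem exists_lt_mul_of_youngCompl (hΨ : IsYoungFunction Ψ)
    (hΨ' : IsYoungFunction (youngCompl Ψ)) {ε : ℝ} (hε : 0 < ε) : ∃ w, 0 < w ∧ Ψ w < ε * w := by
  by_contra! h
  refine hε.ne' ((hΨ'.eq_zero_iff ε).1 (le_antisymm (youngCompl_le fun x hx => ?_)
    (hΨ.youngCompl_nonneg ε)))
  rcases hx.eq_or_lt with rfl | hx
  · simp [hΨ.map_zero]
  · rw [abs_of_pos hε]; linarith [h x hx]

end IsYoungFunction

theorem youngInv_mono (Φ : ℝ → ℝ) : Monotone (youngInv Φ) := fun _ _ h =>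
  iSup₂_le fun x hx => le_iSup₂_of_le x (hx.trans h) le_rfl

theorem le_ofReal_of_youngInv_lt {Φ : ℝ → ℝ} {t : ℝ≥0∞} {s : ℝ≥0} (h : youngInv Φ t < s) :
    t ≤ ENNReal.ofReal (Φ s) := by
  by_contra! hlt
  exact absurd h (not_lt.2 (le_iSup₂_of_le s hlt.le le_rfl))

theorem youngInv_lt_top {Φ : ℝ → ℝ} (hΦ : Tendsto Φ atTop atTop) {t : ℝ≥0∞} (ht : t ≠ ∞) :
    youngInv Φ t < ∞ := by
  obtain ⟨X, hX⟩ := (hΦ.eventually_gt_atTop t.toReal).exists_forall_of_atTop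
  refine (iSup₂_le fun x hx => ?_).trans_lt (ENNReal.ofReal_lt_top (r := X))
  by_contra! hlt
  rw [← ENNReal.ofReal_coe_nnreal] at hlt
  have h1 := hX x (ENNReal.ofReal_lt_ofReal_iff'.1 hlt).1.le
  exact absurd hx (not_le.2 ((ENNReal.lt_ofReal_iff_toReal_lt ht).2 h1))

/-- `Φ (Φ⁻¹ t) ≤ t`, in a form that avoids evaluating `Φ` at `∞`. -/
theorem IsYoungFunction.ofReal_le_of_le_youngInv {Φ : ℝ → ℝ} (hΦ : IsYoungFunction Φ)
    {t : ℝ≥0∞} {s : ℝ≥0} (h : (s : ℝ≥0∞) ≤ youngInv Φ t) : ENNReal.ofReal (Φ s) ≤ t := by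
  rcases eq_or_ne s 0 with rfl | hs
  · simp [hΦ.map_zero]
  have hcont : Continuous fun x : ℝ≥0 => ENNReal.ofReal (Φ x) :=
    ENNReal.continuous_ofReal.comp (hΦ.continuous.comp NNReal.continuous_coe)
  -- Below the supremum the inequality holds by monotonicity; pass to the limit from the left.
  have hlt : ∀ x : ℝ≥0, x < s → ENNReal.ofReal (Φ x) ≤ t := by
    intro x hx
    have h1 : (x : ℝ≥0∞) < youngInv Φ t := (ENNReal.coe_lt_coe.2 hx).trans_le h
    obtain ⟨y, hy⟩ := lt_iSup_iff.1 h1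
    obtain ⟨hyt, hxy⟩ := lt_iSup_iff.1 hy
    exact (ENNReal.ofReal_le_ofReal (hΦ.mono x.2 (NNReal.coe_le_coe.2
      (ENNReal.coe_lt_coe.1 hxy).le))).trans hyt
  have hcl : s ∈ closure (Set.Iio s) := by
    rw [closure_Iio' ⟨0, pos_iff_ne_zero.2 hs⟩]; exact Set.self_mem_Iic
  exact closure_minimal (s := Set.Iio s) (t := {x : ℝ≥0 | ENNReal.ofReal (Φ x) ≤ t})
    hlt (isClosed_le hcont continuous_const) hcl

/-! ### The conditional expectation -/

section CondExp

variable {Ω : Type*} {𝒜 mΩ : MeasurableSpace Ω}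

/-- The pull-out property of the conditional expectation of `[0, ∞]`-valued functions. -/
theorem condLExp_mul_left (h𝒜 : 𝒜 ≤ mΩ) (μ : Measure[mΩ] Ω) [SigmaFinite (μ.trim h𝒜)]
    {g X : Ω → ℝ≥0∞} (hg : Measurable[𝒜] g) (hX : Measurable[mΩ] X) :
    condLExp 𝒜 μ (fun x => g x * X x) =ᵐ[μ] fun x => g x * condLExp 𝒜 μ X x := by
  have hE := measurable_condLExp 𝒜 μ X
  refine (ae_eq_condLExp h𝒜 μ _ (hg.mul hE) fun s hs => ?_).symm
  -- The measures with densities `E X` and `X` agree on `𝒜`.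
  have key : (μ.withDensity (condLExp 𝒜 μ X)).trim h𝒜 = (μ.withDensity X).trim h𝒜 := by
    refine @Measure.ext _ 𝒜 _ _ fun t ht => ?_
    rw [trim_measurableSet_eq h𝒜 ht, trim_measurableSet_eq h𝒜 ht, withDensity_apply _ (h𝒜 t ht),
      withDensity_apply _ (h𝒜 t ht), setLIntegral_condLExp h𝒜 μ X ht]
  have aux : ∀ Y : Ω → ℝ≥0∞, Measurable[mΩ] Y → ∫⁻ x in s, g x * Y x ∂μ
      = ∫⁻ x, s.indicator g x ∂((μ.withDensity Y).trim h𝒜) := by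
    intro Y hY
    rw [lintegral_trim h𝒜 (hg.indicator hs),
      lintegral_withDensity_eq_lintegral_mul _ hY ((hg.indicator hs).mono h𝒜 le_rfl),
      ← lintegral_indicator (h𝒜 s hs)]
    refine lintegral_congr fun x => ?_
    by_cases hx : x ∈ s <;> simp [hx, mul_comm]
  exact (aux _ (hE.mono h𝒜 le_rfl)).trans (key ▸ (aux X hX).symm)

theorem measurable_condExpReal (μ : Measure[mΩ] Ω) (f : Ω → ℝ) :
    Measurable[𝒜] (condExpReal 𝒜 μ f) :=
  (measurable_condLExp 𝒜 μ _).ennreal_toReal.sub (measurable_condLExp 𝒜 μ _).ennreal_toReal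

theorem measurable_condExpComplex (μ : Measure[mΩ] Ω) (f : Ω → ℂ) :
    Measurable[𝒜] (condExpComplex 𝒜 μ f) := by
  have h : condExpComplex 𝒜 μ f = fun x =>
      ((condExpReal 𝒜 μ (fun y => (f y).re) x : ℝ) : ℂ)
        + ((condExpReal 𝒜 μ (fun y => (f y).im) x : ℝ) : ℂ) * Complex.I := by
    funext x
    exact (Complex.re_add_im _).symm
  rw [h]
  exact (Complex.measurable_ofReal.comp (measurable_condExpReal μ _)).add
    ((Complex.measurable_ofReal.comp (measurable_condExpReal μ _)).mul_const _)

/-- The real conditional expectation pulls out nonnegative finite `𝒜`-measurable factors. -/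
theorem condExpReal_mul_left (h𝒜 : 𝒜 ≤ mΩ) (μ : Measure[mΩ] Ω) [SigmaFinite (μ.trim h𝒜)]
    {g f : Ω → ℝ} (hg : Measurable[𝒜] g) (hg0 : ∀ x, 0 ≤ g x) (hf : Measurable[mΩ] f) :
    condExpReal 𝒜 μ (fun x => g x * f x) =ᵐ[μ] fun x => g x * condExpReal 𝒜 μ f x := by
  have h1 := condLExp_mul_left h𝒜 μ hg.ennreal_ofReal hf.ennreal_ofReal
  have h2 := condLExp_mul_left h𝒜 μ hg.ennreal_ofReal hf.neg.ennreal_ofReal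
  filter_upwards [h1, h2] with x hx1 hx2
  simp only [condExpReal, ← mul_neg, ENNReal.ofReal_mul (hg0 _)]
  simp only [Pi.neg_apply] at hx2
  rw [hx1, hx2, ENNReal.toReal_mul, ENNReal.toReal_mul, ENNReal.toReal_ofReal (hg0 x), mul_sub]

theorem condExpComplex_mul_left (h𝒜 : 𝒜 ≤ mΩ) (μ : Measure[mΩ] Ω) [SigmaFinite (μ.trim h𝒜)]
    {g : Ω → ℝ} {f : Ω → ℂ} (hg : Measurable[𝒜] g) (hg0 : ∀ x, 0 ≤ g x) (hf : Measurable[mΩ] f) :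
    condExpComplex 𝒜 μ (fun x => g x * f x) =ᵐ[μ] fun x => g x * condExpComplex 𝒜 μ f x := by
  have h1 := condExpReal_mul_left h𝒜 μ hg hg0 (Complex.measurable_re.comp hf)
  have h2 := condExpReal_mul_left h𝒜 μ hg hg0 (Complex.measurable_im.comp hf)
  filter_upwards [h1, h2] with x hx1 hx2
  apply Complex.ext
  · simpa [condExpComplex, Function.comp_def] using hx1
  · simpa [condExpComplex, Function.comp_def] using hx2

theorem condExpComplex_ofReal (h𝒜 : 𝒜 ≤ mΩ) (μ : Measure[mΩ] Ω) [SigmaFinite (μ.trim h𝒜)]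
    {f : Ω → ℝ} (hf0 : ∀ x, 0 ≤ f x) (x : Ω) :
    condExpComplex 𝒜 μ (fun x => (f x : ℂ)) x
      = (condLExp 𝒜 μ (fun y => ENNReal.ofReal (f y)) x).toReal := by
  have h0 : (fun _ : Ω => (0 : ℝ≥0∞)) = 0 := rfl
  apply Complex.ext <;>
    simp [condExpComplex, condExpReal, ENNReal.ofReal_of_nonpos, hf0, h0]

theorem norm_le_of_forall_rat_re_im {z : ℂ} {M : ℝ}
    (h : ∀ p q : ℚ, p * z.re + q * z.im ≤ ‖(⟨p, q⟩ : ℂ)‖ * M) : ‖z‖ ≤ M := by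
  have hc : Continuous fun w : ℝ × ℝ => (⟨w.1, w.2⟩ : ℂ) :=
    Complex.equivRealProdCLM.symm.continuous
  have key : ∀ p q : ℝ, p * z.re + q * z.im ≤ ‖(⟨p, q⟩ : ℂ)‖ * M :=
    Rat.denseRange_cast.induction_on₂
      (isClosed_le (by fun_prop) (hc.norm.mul continuous_const)) h
  have h1 := key z.re z.im
  have h2 : ‖z‖ * ‖z‖ = z.re * z.re + z.im * z.im := by
    rw [← Complex.normSq_apply, Complex.normSq_eq_norm_sq, sq]
  rw [Complex.eta, ← h2] at h1
  rcases (norm_nonneg z).eq_or_lt with h0 | h0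
  · -- At `z = 0` the bound is only used to see that `M` is nonnegative.
    have h3 := key 1 0
    have hz : z = 0 := norm_eq_zero.1 h0.symm
    have h4 : ‖(⟨1, 0⟩ : ℂ)‖ = 1 := by
      have : (⟨1, 0⟩ : ℂ) = 1 := rfl
      rw [this, norm_one]
    rw [h4, hz] at h3
    rw [← h0]
    simpa using h3
  · exact le_of_mul_le_mul_left h1 h0

/-- `|E f| ≤ E |f|`. For rational `p, q` the inequality `p Re f + q Im f ≤ |p + q i| |f|`, with the
negative terms moved to the other side, passes to the conditional expectations. -/
theorem norm_condExpComplex_le (h𝒜 : 𝒜 ≤ mΩ) (μ : Measure[mΩ] Ω) [SigmaFinite (μ.trim h𝒜)]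
    {f : Ω → ℂ} (hf : Conditionable 𝒜 μ f) :
    ∀ᵐ x ∂μ, ‖condExpComplex 𝒜 μ f x‖ ≤ (condLExp 𝒜 μ (fun x => ‖f x‖ₑ) x).toReal := by
  have hr := Complex.measurable_re.comp hf.1
  have hi := Complex.measurable_im.comp hf.1
  set E := condLExp 𝒜 μ with hE
  let R₁ : Ω → ℝ≥0∞ := fun y => ENNReal.ofReal (f y).re
  let R₂ : Ω → ℝ≥0∞ := fun y => ENNReal.ofReal (-(f y).re)
  let I₁ : Ω → ℝ≥0∞ := fun y => ENNReal.ofReal (f y).im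
  let I₂ : Ω → ℝ≥0∞ := fun y => ENNReal.ofReal (-(f y).im)
  let N : Ω → ℝ≥0∞ := fun y => ‖f y‖ₑ
  have mR₁ : Measurable[mΩ] R₁ := hr.ennreal_ofReal
  have mR₂ : Measurable[mΩ] R₂ := hr.neg.ennreal_ofReal
  have mI₁ : Measurable[mΩ] I₁ := hi.ennreal_ofReal
  have mI₂ : Measurable[mΩ] I₂ := hi.neg.ennreal_ofReal
  have mN : Measurable[mΩ] N := hf.1.enorm
  have hle : ∀ (g : Ω → ℝ), (∀ y, g y ≤ ‖f y‖) →
      ∀ᵐ x ∂μ, E (fun y => ENNReal.ofReal (g y)) x ≤ E N x := fun g hg =>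
    condLExp_mono (Eventually.of_forall fun y => by
      simp only [N, ← ofReal_norm]
      exact ENNReal.ofReal_le_ofReal (hg y))
  have hR₁ := hle (fun y => (f y).re) fun y => (le_abs_self _).trans (Complex.abs_re_le_norm _)
  have hR₂ := hle (fun y => -(f y).re) fun y => (neg_le_abs _).trans (Complex.abs_re_le_norm _)
  have hI₁ := hle (fun y => (f y).im) fun y => (le_abs_self _).trans (Complex.abs_im_le_norm _)
  have hI₂ := hle (fun y => -(f y).im) fun y => (neg_le_abs _).trans (Complex.abs_im_le_norm _)
  have hlin : ∀ (c₁ c₂ c₃ c₄ c₅ : ℝ≥0∞) (X₁ X₂ X₃ X₄ X₅ : Ω → ℝ≥0∞), Measurable[mΩ] X₁ →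
      Measurable[mΩ] X₂ → Measurable[mΩ] X₃ → Measurable[mΩ] X₄ → Measurable[mΩ] X₅ →
      E (c₁ • X₁ + (c₂ • X₂ + (c₃ • X₃ + (c₄ • X₄ + c₅ • X₅)))) =ᵐ[μ] fun x =>
        c₁ * E X₁ x + (c₂ * E X₂ x + (c₃ * E X₃ x + (c₄ * E X₄ x + c₅ * E X₅ x))) := by
    intro c₁ c₂ c₃ c₄ c₅ X₁ X₂ X₃ X₄ X₅ m₁ m₂ m₃ m₄ m₅
    filter_upwards [condLExp_add_left (mΩ := 𝒜)
        (c₂ • X₂ + (c₃ • X₃ + (c₄ • X₄ + c₅ • X₅))) (m₁.const_smul c₁).aemeasurable,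
      condLExp_add_left (mΩ := 𝒜) (c₃ • X₃ + (c₄ • X₄ + c₅ • X₅)) (m₂.const_smul c₂).aemeasurable,
      condLExp_add_left (mΩ := 𝒜) (c₄ • X₄ + c₅ • X₅) (m₃.const_smul c₃).aemeasurable,
      condLExp_add_left (mΩ := 𝒜) (c₅ • X₅) (m₄.const_smul c₄).aemeasurable,
      condLExp_smul (mΩ := 𝒜) X₁ m₁.aemeasurable c₁, condLExp_smul (mΩ := 𝒜) X₂ m₂.aemeasurable c₂,
      condLExp_smul (mΩ := 𝒜) X₃ m₃.aemeasurable c₃, condLExp_smul (mΩ := 𝒜) X₄ m₄.aemeasurable c₄,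
      condLExp_smul (mΩ := 𝒜) X₅ m₅.aemeasurable c₅] with x h1 h2 h3 h4 s1 s2 s3 s4 s5
    simp only [Pi.add_apply, Pi.smul_apply, smul_eq_mul] at h1 h2 h3 h4 s1 s2 s3 s4 s5
    rw [hE, h1, h2, h3, h4, s1, s2, s3, s4, s5]
  have key : ∀ᵐ x ∂μ, ∀ p q : ℚ,
      p * (condExpComplex 𝒜 μ f x).re + q * (condExpComplex 𝒜 μ f x).im
        ≤ ‖(⟨p, q⟩ : ℂ)‖ * (E N x).toReal := by
    refine ae_all_iff.2 fun p => ae_all_iff.2 fun q => ?_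
    let a : ℝ → ℝ≥0∞ := fun t => ENNReal.ofReal t
    have e1 := hlin (a p) (a (-p)) (a q) (a (-q)) 0 R₁ R₂ I₁ I₂ N mR₁ mR₂ mI₁ mI₂ mN
    have e2 := hlin (a p) (a (-p)) (a q) (a (-q)) (a ‖(⟨p, q⟩ : ℂ)‖) R₂ R₁ I₂ I₁ N
      mR₂ mR₁ mI₂ mI₁ mN
    have hmono : a p • R₁ + (a (-p) • R₂ + (a q • I₁ + (a (-q) • I₂ + (0 : ℝ≥0∞) • N)))
        ≤ᵐ[μ] a p • R₂ + (a (-p) • R₁ + (a q • I₂ + (a (-q) • I₁ + a ‖(⟨p, q⟩ : ℂ)‖ • N))) := by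
      refine Eventually.of_forall fun y => ?_
      have hpt : (p : ℝ) * (f y).re + q * (f y).im ≤ ‖(⟨p, q⟩ : ℂ)‖ * ‖f y‖ := by
        have h1 := Complex.re_le_norm ((⟨p, -q⟩ : ℂ) * f y)
        have h2 : ‖(⟨p, -q⟩ : ℂ)‖ = ‖(⟨p, q⟩ : ℂ)‖ := by
          rw [← Complex.norm_conj]; congr 1; apply Complex.ext <;> simp
        rw [norm_mul, h2] at h1
        simpa using h1
      simp only [Pi.add_apply, Pi.smul_apply, smul_eq_mul, zero_mul, add_zero, R₁, R₂, I₁, I₂, N, a,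
        ← ofReal_norm]
      rw [← ENNReal.toReal_le_toReal (by finiteness) (by finiteness)]
      repeat rw [ENNReal.toReal_add (by finiteness) (by finiteness)]
      simp only [ENNReal.toReal_mul, ENNReal.toReal_ofReal', norm_nonneg, max_eq_left]
      have hp := max_zero_sub_max_neg_zero_eq_self (p : ℝ)
      have hq := max_zero_sub_max_neg_zero_eq_self (q : ℝ)
      have hr := max_zero_sub_max_neg_zero_eq_self (f y).re
      have hi := max_zero_sub_max_neg_zero_eq_self (f y).im
      have e : (p : ℝ) * (f y).re + q * (f y).im
          = (max (p : ℝ) 0 - max (-p : ℝ) 0) * (max (f y).re 0 - max (-(f y).re) 0)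
            + (max (q : ℝ) 0 - max (-q : ℝ) 0) * (max (f y).im 0 - max (-(f y).im) 0) := by
        rw [hp, hq, hr, hi]
      rw [e] at hpt
      linarith
    filter_upwards [e1, e2, condLExp_mono (mΩ := 𝒜) hmono, hf.2, hR₁, hR₂, hI₁, hI₂]
      with x h1 h2 h3 hN b1 b2 b3 b4
    change E N x < ∞ at hN
    have t1 : E R₁ x ≠ ∞ := (b1.trans_lt hN).ne
    have t2 : E R₂ x ≠ ∞ := (b2.trans_lt hN).ne
    have t3 : E I₁ x ≠ ∞ := (b3.trans_lt hN).ne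
    have t4 : E I₂ x ≠ ∞ := (b4.trans_lt hN).ne
    have t5 : E N x ≠ ∞ := hN.ne
    rw [← hE, h1, h2, ← ENNReal.toReal_le_toReal (by finiteness) (by finiteness)] at h3
    repeat rw [ENNReal.toReal_add (by finiteness) (by finiteness)] at h3
    simp only [ENNReal.toReal_mul, ENNReal.toReal_ofReal', norm_nonneg, max_eq_left, a,
      ENNReal.toReal_zero, zero_mul, add_zero] at h3
    have hp := max_zero_sub_max_neg_zero_eq_self (p : ℝ)
    have hq := max_zero_sub_max_neg_zero_eq_self (q : ℝ)
    have e : (p : ℝ) * (condExpComplex 𝒜 μ f x).re + q * (condExpComplex 𝒜 μ f x).im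
          = (max (p : ℝ) 0 - max (-p : ℝ) 0) * ((E R₁ x).toReal - (E R₂ x).toReal)
            + (max (q : ℝ) 0 - max (-q : ℝ) 0) * ((E I₁ x).toReal - (E I₂ x).toReal) := by
      rw [hp, hq]; rfl
    rw [e]
    linarith
  filter_upwards [key] with x hx
  exact norm_le_of_forall_rat_re_im hx

end CondExp

/-! ### Orlicz spaces -/

section Orlicz

variable {Ω : Type*} {mΩ : MeasurableSpace Ω} {μ : Measure[mΩ] Ω} {Φ Ψ : ℝ → ℝ}

/-- The modular of a scaled function scales at least linearly. -/
theorem IsYoungFunction.lintegral_mul_le (hΦ : IsYoungFunction Φ) {s : ℝ} (hs0 : 0 ≤ s)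
    (hs1 : s ≤ 1) (f : Ω → ℝ) :
    ∫⁻ x, ENNReal.ofReal (Φ (s * f x)) ∂μ
      ≤ ENNReal.ofReal s * ∫⁻ x, ENNReal.ofReal (Φ (f x)) ∂μ := by
  rw [← lintegral_const_mul' _ _ ENNReal.ofReal_ne_top]
  refine lintegral_mono fun x => ?_
  rw [← ENNReal.ofReal_mul hs0]
  exact ENNReal.ofReal_le_ofReal (hΦ.map_mul_le _ hs0 hs1)

theorem luxemburgNorm_le {f : Ω → ℂ} {k : ℝ} (hk : 0 < k)
    (h : ∫⁻ x, ENNReal.ofReal (Φ (‖f x‖ / k)) ∂μ ≤ 1) :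
    luxemburgNorm Φ μ f ≤ ENNReal.ofReal k :=
  iInf_le_of_le k (iInf_le_of_le hk (iInf_le _ h))

theorem MemOrlicz.exists_lintegral_le_one (hΦ : IsYoungFunction Φ) {f : Ω → ℂ}
    (hf : MemOrlicz Φ μ f) :
    ∃ k : ℝ, 0 < k ∧ ∫⁻ x, ENNReal.ofReal (Φ (‖f x‖ / k)) ∂μ ≤ 1 := by
  obtain ⟨-, k, hk, hfin⟩ := hf
  set I := ∫⁻ x, ENNReal.ofReal (Φ (k * ‖f x‖)) ∂μ with hI
  have hI1 : 0 < I.toReal + 1 := by positivity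
  have h := hΦ.lintegral_mul_le (μ := μ) (s := 1 / (I.toReal + 1)) (by positivity)
    (by rw [div_le_one hI1]; linarith [I.toReal_nonneg]) (fun x => k * ‖f x‖)
  refine ⟨(I.toReal + 1) / k, by positivity, ?_⟩
  have e : ∀ x, 1 / (I.toReal + 1) * (k * ‖f x‖) = ‖f x‖ / ((I.toReal + 1) / k) := by
    intro x; field_simp
  simp only [e] at h
  refine h.trans ?_
  rw [← hI, ← ENNReal.ofReal_toReal hfin.ne, ← ENNReal.ofReal_mul (by positivity),
    ENNReal.ofReal_le_one, ENNReal.toReal_ofReal I.toReal_nonneg, one_div_mul_eq_div,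
    div_le_one hI1]
  linarith

theorem MemOrlicz.luxemburgNorm_lt_top (hΦ : IsYoungFunction Φ) {f : Ω → ℂ}
    (hf : MemOrlicz Φ μ f) : luxemburgNorm Φ μ f < ∞ := by
  obtain ⟨k, hk, h⟩ := hf.exists_lintegral_le_one hΦ
  exact (luxemburgNorm_le hk h).trans_lt ENNReal.ofReal_lt_top

/-- A bound by a multiple of every admissible constant is a bound by a multiple of the norm. -/
theorem MemOrlicz.le_mul_luxemburgNorm (hΦ : IsYoungFunction Φ) {f : Ω → ℂ}
    (hf : MemOrlicz Φ μ f) {c X : ℝ≥0∞} (hc : c ≠ ∞)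
    (h : ∀ k : ℝ, 0 < k → ∫⁻ x, ENNReal.ofReal (Φ (‖f x‖ / k)) ∂μ ≤ 1 →
      X ≤ c * ENNReal.ofReal k) : X ≤ c * luxemburgNorm Φ μ f := by
  rcases eq_or_ne c 0 with rfl | hc0
  · obtain ⟨k, hk, hk1⟩ := hf.exists_lintegral_le_one hΦ
    simpa using h k hk hk1
  · rw [mul_comm, ← ENNReal.div_le_iff hc0 hc]
    refine le_iInf₂ fun k hk => le_iInf fun hk1 => ?_
    rw [ENNReal.div_le_iff hc0 hc, mul_comm]
    exact h k hk hk1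

/-- Enlarging `f` in absolute value by a factor `l` on `A` enlarges the norm accordingly. -/
theorem mul_luxemburgNorm_indicator_le (hΨ : IsYoungFunction Ψ) {A : Set Ω} {g : Ω → ℂ} {l : ℝ}
    (hl : 0 < l) (h : ∀ᵐ x ∂μ, x ∈ A → l ≤ ‖g x‖) :
    ENNReal.ofReal l * luxemburgNorm Ψ μ (A.indicator 1) ≤ luxemburgNorm Ψ μ g := by
  refine le_iInf₂ fun k hk => le_iInf fun hk1 => ?_
  have h1 : luxemburgNorm Ψ μ (A.indicator 1) ≤ ENNReal.ofReal (k / l) := by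
    refine luxemburgNorm_le (by positivity) ((lintegral_mono_ae ?_).trans hk1)
    filter_upwards [h] with x hx
    refine ENNReal.ofReal_le_ofReal (hΨ.mono (by positivity) ?_)
    by_cases hxA : x ∈ A
    · have := hx hxA
      simp only [hxA, Set.indicator_of_mem, Pi.one_apply, norm_one]
      rw [one_div_div]
      gcongr
    · simp only [hxA, not_false_eq_true, Set.indicator_of_notMem, norm_zero, zero_div]
      positivity
  calc _ ≤ ENNReal.ofReal l * ENNReal.ofReal (k / l) := by gcongr
    _ = ENNReal.ofReal k := by rw [← ENNReal.ofReal_mul hl.le, mul_div_cancel₀ _ hl.ne']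

theorem lintegral_young_indicator_one (hΨ : IsYoungFunction Ψ) {A : Set Ω} (hA : MeasurableSet A)
    (k : ℝ) : ∫⁻ x, ENNReal.ofReal (Ψ (k * ‖A.indicator (1 : Ω → ℂ) x‖)) ∂μ
      = ENNReal.ofReal (Ψ k) * μ A := by
  rw [← lintegral_indicator_const hA]
  refine lintegral_congr fun x => ?_
  by_cases hx : x ∈ A <;> simp [hx, hΨ.map_zero]

theorem memOrlicz_indicator_one (hΨ : IsYoungFunction Ψ) {A : Set Ω} (hA : MeasurableSet A)
    (hμA : μ A < ∞) : MemOrlicz Ψ μ (A.indicator 1) :=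
  ⟨measurable_one.indicator hA, 1, one_pos, by
    rw [lintegral_young_indicator_one hΨ hA]; exact ENNReal.mul_lt_top ENNReal.ofReal_lt_top hμA⟩

theorem luxemburgNorm_indicator_one_ne_zero (hΨ : IsYoungFunction Ψ) {A : Set Ω}
    (hA : MeasurableSet A) (hμA : μ A ≠ 0) : luxemburgNorm Ψ μ (A.indicator 1) ≠ 0 := by
  -- Admissible constants `k` satisfy `Ψ (1 / k) * μ A ≤ 1`, which bounds `1 / k` from above.
  have ht : Tendsto (fun x => ENNReal.ofReal (Ψ x) * μ A) atTop (nhds ∞) := by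
    have := ENNReal.Tendsto.mul_const (b := μ A)
      (ENNReal.tendsto_ofReal_atTop.comp hΨ.tendsto_atTop) (Or.inl ENNReal.top_ne_zero)
    rwa [ENNReal.top_mul hμA] at this
  obtain ⟨X, hX⟩ := (ht.eventually (lt_mem_nhds ENNReal.one_lt_top)).exists_forall_of_atTop
  have hpos : 0 < max X 1 := lt_of_lt_of_le one_pos (le_max_right _ _)
  refine ne_of_gt (lt_of_lt_of_le (ENNReal.ofReal_pos.2 (one_div_pos.2 hpos)) ?_)
  refine le_iInf₂ fun k hk => le_iInf fun hk1 => ENNReal.ofReal_le_ofReal ?_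
  by_contra! hlt
  simp only [div_eq_inv_mul _ k] at hk1
  rw [lintegral_young_indicator_one hΨ hA] at hk1
  refine absurd hk1 (not_le.2 (hX _ ?_))
  rw [lt_div_iff₀ hpos] at hlt
  refine (le_max_left X 1).trans ?_
  rw [← one_div, le_div_iff₀ hk]
  linarith

/-- If `Φ x ≤ Ψ (a x)` for `x ≥ T`, then the modular for `Φ` exceeds the one for `Ψ` by at most
`N = Φ(T) μ(Ω)`. For `T = 0` this holds also when `μ(Ω) = ∞`, since then `N = 0 * ∞ = 0`. -/
theorem YoungDomWith.lintegral_le (hΦ : IsYoungFunction Φ) {a T : ℝ}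
    (h : YoungDomWith Φ Ψ a T) {f : Ω → ℂ} (k : ℝ) (hk : 0 ≤ k) :
    ∫⁻ x, ENNReal.ofReal (Φ (k * ‖f x‖)) ∂μ
      ≤ ENNReal.ofReal (Φ T) * μ Set.univ
        + ∫⁻ x, ENNReal.ofReal (Ψ (a * (k * ‖f x‖))) ∂μ := by
  rw [← lintegral_const, ← lintegral_add_left measurable_const]
  refine lintegral_mono fun x => ?_
  rcases le_total T (k * ‖f x‖) with hT | hT
  · exact le_add_left (ENNReal.ofReal_le_ofReal (h.2.2 _ hT))
  · exact le_add_right (ENNReal.ofReal_le_ofReal (hΦ.mono (by positivity) hT))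

theorem YoungDomWith.memOrlicz (hΦ : IsYoungFunction Φ) (hΨ : IsYoungFunction Ψ) {a T : ℝ}
    (h : YoungDomWith Φ Ψ a T) (hN : ENNReal.ofReal (Φ T) * μ Set.univ < ∞) {f : Ω → ℂ}
    (hf : MemOrlicz Ψ μ f) : MemOrlicz Φ μ f := by
  obtain ⟨hm, k, hk, hfin⟩ := hf
  have ha := hΦ.dom_pos hΨ h
  refine ⟨hm, k / a, by positivity, (h.lintegral_le hΦ _ (by positivity)).trans_lt ?_⟩
  have e : ∀ x, a * (k / a * ‖f x‖) = k * ‖f x‖ := fun x => by field_simp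
  simp only [e]
  exact ENNReal.add_lt_top.2 ⟨hN, hfin⟩

/-- The continuous inclusion of `L^Ψ` into `L^Φ` for `Φ ⪯ Ψ`. -/
theorem YoungDomWith.luxemburgNorm_le (hΦ : IsYoungFunction Φ) (hΨ : IsYoungFunction Ψ) {a T : ℝ}
    (h : YoungDomWith Φ Ψ a T) (hN : ENNReal.ofReal (Φ T) * μ Set.univ < ∞) {f : Ω → ℂ}
    (hf : MemOrlicz Ψ μ f) :
    luxemburgNorm Φ μ f ≤
      ENNReal.ofReal a * (ENNReal.ofReal (Φ T) * μ Set.univ + 1) * luxemburgNorm Ψ μ f := by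
  have ha := hΦ.dom_pos hΨ h
  refine hf.le_mul_luxemburgNorm hΨ (by finiteness) fun k hk hk1 => ?_
  set N := ENNReal.ofReal (Φ T) * μ Set.univ with hNdef
  have hN1 : 0 < N.toReal + 1 := by positivity
  have e1 : ENNReal.ofReal a * (N + 1) * ENNReal.ofReal k
      = ENNReal.ofReal (a * (N.toReal + 1) * k) := by
    rw [ENNReal.ofReal_mul (by positivity), ENNReal.ofReal_mul ha.le,
      ENNReal.ofReal_add N.toReal_nonneg zero_le_one, ENNReal.ofReal_toReal hN.ne,
      ENNReal.ofReal_one]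
  rw [e1]
  refine _root_.luxemburgNorm_le (by positivity) ?_
  have h1 := h.lintegral_le hΦ (μ := μ) (f := f) (1 / (a * k)) (by positivity)
  have e2 : ∀ x, a * (1 / (a * k) * ‖f x‖) = ‖f x‖ / k := fun x => by field_simp
  simp only [e2] at h1
  have h2 := hΦ.lintegral_mul_le (μ := μ) (s := 1 / (N.toReal + 1)) (by positivity)
    (by rw [div_le_one hN1]; linarith [N.toReal_nonneg]) (fun x => 1 / (a * k) * ‖f x‖)
  have e3 : ∀ x, 1 / (N.toReal + 1) * (1 / (a * k) * ‖f x‖) = ‖f x‖ / (a * (N.toReal + 1) * k) :=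
    fun x => by field_simp
  simp only [e3] at h2
  refine h2.trans ?_
  calc _ ≤ ENNReal.ofReal (1 / (N.toReal + 1)) * (N + 1) := by
        gcongr; exact h1.trans (by gcongr)
    _ = 1 := by
        rw [← ENNReal.ofReal_toReal hN.ne, ← ENNReal.ofReal_one,
          ← ENNReal.ofReal_add N.toReal_nonneg zero_le_one, ← ENNReal.ofReal_mul (by positivity),
          ENNReal.toReal_ofReal N.toReal_nonneg, one_div_mul_cancel hN1.ne']

/-- Both cases of the comparison adapted to `μ(Ω)` make `N = Φ(T) μ(Ω)` finite. -/
theorem YoungDomFor.exists_domWith (hΦ : IsYoungFunction Φ) (h : YoungDomFor μ Φ Ψ) :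
    ∃ a T, YoungDomWith Φ Ψ a T ∧ ENNReal.ofReal (Φ T) * μ Set.univ < ∞ := by
  rcases h with ⟨hμ, a, T, h⟩ | ⟨-, a, h⟩
  · exact ⟨a, T, h, ENNReal.mul_lt_top ENNReal.ofReal_lt_top hμ⟩
  · exact ⟨a, 0, h, by simp [hΦ.map_zero]⟩

end Orlicz

/-! ### Necessary conditions for boundedness -/

section Operator

variable {Ω : Type*} {𝒜 mΩ : MeasurableSpace Ω} {μ : Measure[mΩ] Ω} {Φ Ψ : ℝ → ℝ} {u : Ω → ℂ}

/-- A property that holds almost everywhere on each `𝒜`-measurable set of finite measure holds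
almost everywhere. -/
theorem ae_of_forall_finite_measure (h𝒜 : 𝒜 ≤ mΩ) [SigmaFinite (μ.trim h𝒜)] {p : Ω → Prop}
    (h : ∀ A, MeasurableSet[𝒜] A → μ A < ∞ → ∀ᵐ x ∂μ, x ∈ A → p x) : ∀ᵐ x ∂μ, p x := by
  have h1 : ∀ᵐ x ∂μ, ∀ n, x ∈ spanningSets (μ.trim h𝒜) n → p x :=
    ae_all_iff.2 fun n => h _ (measurableSet_spanningSets _ n)
      (measure_spanningSets_trim_lt_top h𝒜 μ n)
  filter_upwards [h1] with x hx
  obtain ⟨n, hn⟩ := Set.mem_iUnion.1 ((iUnion_spanningSets (μ.trim h𝒜)).symm ▸ Set.mem_univ x)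
  exact hx n hn

/-- A bounded operator `R_u` cannot produce a value above `K B` in absolute value on a set `A` of
positive measure from a function whose norm is at most that of the indicator of `A`. -/
theorem measure_eq_zero_of_le_norm_wct (hΨ : IsYoungFunction Ψ)
    (h𝒜 : 𝒜 ≤ mΩ)
    {K B : ℝ≥0} (hK : ∀ f, MemOrlicz Φ μ f →
      luxemburgNorm Ψ μ (wct 𝒜 μ u f) ≤ K * luxemburgNorm Φ μ f)
    (hB : ∀ f, MemOrlicz Ψ μ f → MemOrlicz Φ μ f ∧ luxemburgNorm Φ μ f ≤ B * luxemburgNorm Ψ μ f)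
    {A : Set Ω} (hA : MeasurableSet[𝒜] A) (hμA : μ A < ∞) {f : Ω → ℂ} (hf : MemOrlicz Ψ μ f)
    (hfA : luxemburgNorm Ψ μ f ≤ luxemburgNorm Ψ μ (A.indicator 1)) {l : ℝ} (hl : K * B < l)
    (hval : ∀ᵐ x ∂μ, x ∈ A → l ≤ ‖wct 𝒜 μ u f x‖) : μ A = 0 := by
  by_contra h0
  have hl0 : 0 < l := lt_of_le_of_lt (by positivity) hl
  have hfin := (memOrlicz_indicator_one hΨ (h𝒜 A hA) hμA).luxemburgNorm_lt_top hΨ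
  have hne := luxemburgNorm_indicator_one_ne_zero hΨ (h𝒜 A hA) h0
  set n := luxemburgNorm Ψ μ (A.indicator 1) with hn
  have h1 : ENNReal.ofReal l * n ≤ (K * B : ℝ≥0∞) * n := by
    calc ENNReal.ofReal l * n ≤ luxemburgNorm Ψ μ (wct 𝒜 μ u f) :=
          mul_luxemburgNorm_indicator_le hΨ hl0 hval
      _ ≤ K * luxemburgNorm Φ μ f := hK f (hB f hf).1
      _ ≤ K * (B * luxemburgNorm Ψ μ f) := by gcongr; exact (hB f hf).2
      _ ≤ K * (B * n) := by gcongr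
      _ = _ := (mul_assoc _ _ _).symm
  rw [ENNReal.mul_le_mul_iff_left hne hfin.ne] at h1
  rw [← ENNReal.coe_mul, ← ENNReal.ofReal_coe_nnreal, ENNReal.ofReal_le_ofReal_iff (by positivity)]
    at h1
  exact absurd hl (not_lt.2 (by simpa using h1))

theorem measurable_indicator_one {α β : Type*} {m : MeasurableSpace α} [MeasurableSpace β] [Zero β]
    [One β] {A : Set α} (hA : MeasurableSet A) : Measurable (A.indicator (1 : α → β)) :=
  measurable_one.indicator hA

theorem ofReal_indicator_one (A : Set Ω) (x : Ω) :
    ((A.indicator (1 : Ω → ℝ) x : ℝ) : ℂ) = A.indicator (1 : Ω → ℂ) x := by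
  by_cases hx : x ∈ A <;> simp [hx]

theorem conditionable_of_wellDefined (hΦ : IsYoungFunction Φ) (h𝒜 : 𝒜 ≤ mΩ)
    [SigmaFinite (μ.trim h𝒜)] (hu : Measurable[mΩ] u) (h : WCTWellDefined 𝒜 μ Φ Ψ u) :
    Conditionable 𝒜 μ u := by
  refine ⟨hu, ae_of_forall_finite_measure h𝒜 fun A hA hμA => ?_⟩
  have h1 := (h _ (memOrlicz_indicator_one hΦ (h𝒜 A hA) hμA)).1.2
  have h2 := condLExp_mul_left h𝒜 μ (g := A.indicator 1)
    (measurable_indicator_one hA) hu.enorm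
  have e : (fun x => ‖u x * A.indicator (1 : Ω → ℂ) x‖ₑ)
      = fun x => A.indicator (1 : Ω → ℝ≥0∞) x * ‖u x‖ₑ := by
    funext x; by_cases hx : x ∈ A <;> simp [hx]
  rw [e] at h1
  filter_upwards [h1, h2] with x hx1 hx2 hxA
  rw [hx2] at hx1
  simpa [hxA] using hx1

theorem memLp_top_of_norm_lt {E : Type*} [NormedAddCommGroup E] [MeasurableSpace E] [BorelSpace E]
    [SecondCountableTopology E] (h𝒜 : 𝒜 ≤ mΩ) {f : Ω → E} (hf : Measurable[𝒜] f) {l : ℝ}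
    (h : ∀ᵐ x ∂μ, ‖f x‖ < l) : MemLp f ∞ (μ.trim h𝒜) := by
  refine memLp_top_of_bound hf.aestronglyMeasurable l ?_
  have : ∀ᵐ x ∂μ, ‖f x‖ ≤ l := h.mono fun _ hx => hx.le
  rw [ae_iff] at this ⊢
  rwa [trim_measurableSet_eq h𝒜]
  exact (measurableSet_le (measurable_norm.comp hf) measurable_const).compl

/-- The test functions are the indicators of `𝒜`-measurable sets of finite measure. -/
theorem memLp_condExpComplex (hΨ : IsYoungFunction Ψ)
    (h𝒜 : 𝒜 ≤ mΩ) [SigmaFinite (μ.trim h𝒜)] (hu : Measurable[mΩ] u)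
    {K B : ℝ≥0} (hK : ∀ f, MemOrlicz Φ μ f →
      luxemburgNorm Ψ μ (wct 𝒜 μ u f) ≤ K * luxemburgNorm Φ μ f)
    (hB : ∀ f, MemOrlicz Ψ μ f →
      MemOrlicz Φ μ f ∧ luxemburgNorm Φ μ f ≤ B * luxemburgNorm Ψ μ f) :
    MemLp (condExpComplex 𝒜 μ u) ∞ (μ.trim h𝒜) := by
  have hm := measurable_condExpComplex (𝒜 := 𝒜) μ u
  refine memLp_top_of_norm_lt h𝒜 hm (l := K * B + 1) ?_
  refine ae_of_forall_finite_measure h𝒜 fun A hA hμA => ?_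
  set S : Set Ω := {x | K * B + 1 ≤ ‖condExpComplex 𝒜 μ u x‖} with hS
  have hSm : MeasurableSet[𝒜] S := measurableSet_le measurable_const (measurable_norm.comp hm)
  have hAS : MeasurableSet[𝒜] (A ∩ S) := MeasurableSet.inter hA hSm
  have hμAS : μ (A ∩ S) < ∞ := (measure_mono Set.inter_subset_left).trans_lt hμA
  have h1 := condExpComplex_mul_left h𝒜 μ (g := (A ∩ S).indicator 1)
    (measurable_indicator_one hAS)
    (fun x => Set.indicator_nonneg (fun _ _ => zero_le_one) x) hu
  have h0 := measure_eq_zero_of_le_norm_wct hΨ h𝒜 hK hB hAS hμAS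
    (memOrlicz_indicator_one hΨ (h𝒜 _ hAS) hμAS) le_rfl (lt_add_one _) (by
      filter_upwards [h1] with x hx hxA
      simp only [ofReal_indicator_one] at hx
      simp only [wct, mul_comm (u _)]
      rw [hx]
      have hxS : K * B + 1 ≤ ‖condExpComplex 𝒜 μ u x‖ := hxA.2
      simpa only [Set.indicator_of_mem hxA, Pi.one_apply, one_mul] using hxS)
  filter_upwards [measure_eq_zero_iff_ae_notMem.1 h0] with x hx hxA
  by_contra! hlt
  exact hx ⟨hxA, hlt⟩

theorem measurable_wctSymbol (μ : Measure[mΩ] Ω) (Ψ : ℝ → ℝ) (u : Ω → ℂ) :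
    Measurable[𝒜] (wctSymbol 𝒜 μ Ψ u) :=
  (youngInv_mono _).measurable.comp (measurable_condLExp 𝒜 μ _)

/-- The heart of the necessity of the second condition. With `v = Ψ*(|u|)`, cut off where `|u|` is
large, and `h = E(v)`, the function `f = conj(sgn u) (v / |u|) (w r / h)` satisfies `R_u f = w r`. Where
`h ≥ r = 1 / (c² Ψ(w))`, the `Δ'` condition bounds the norm of `f` by that of an indicator. As `w` is
chosen with `w r > K B`, the set where `h ≥ r` is null. -/
theorem condLExp_cutoff_lt (hΨ : IsYoungFunction Ψ)
    (h𝒜 : 𝒜 ≤ mΩ) [SigmaFinite (μ.trim h𝒜)] (hu : Measurable[mΩ] u)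
    {K B : ℝ≥0} (hK : ∀ f, MemOrlicz Φ μ f →
      luxemburgNorm Ψ μ (wct 𝒜 μ u f) ≤ K * luxemburgNorm Φ μ f)
    (hB : ∀ f, MemOrlicz Ψ μ f →
      MemOrlicz Φ μ f ∧ luxemburgNorm Φ μ f ≤ B * luxemburgNorm Ψ μ f)
    {c w : ℝ} (hc : 0 < c) (hΔ : ∀ x y, 0 ≤ x → 0 ≤ y → Ψ (x * y) ≤ c * Ψ x * Ψ y)
    (hw : 0 < w) (hwK : (K * B : ℝ) < w * (1 / (c ^ 2 * Ψ w))) (n : ℕ) :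
    ∀ᵐ x ∂μ, condLExp 𝒜 μ ({x | ‖u x‖ ≤ n}.indicator
      fun x => ENNReal.ofReal (youngCompl Ψ ‖u x‖)) x < ENNReal.ofReal (1 / (c ^ 2 * Ψ w)) := by
  have hΨw := hΨ.pos hw.ne'
  set r : ℝ := 1 / (c ^ 2 * Ψ w) with hr
  have hr0 : 0 < r := by positivity
  set v : Ω → ℝ := {x | ‖u x‖ ≤ n}.indicator fun x => youngCompl Ψ ‖u x‖ with hv
  have hvm : Measurable[mΩ] v :=
    (hΨ.measurable_youngCompl_norm hu).indicator (measurableSet_le hu.norm measurable_const)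
  have hv0 : ∀ x, 0 ≤ v x := fun x => Set.indicator_nonneg (fun _ _ => hΨ.youngCompl_nonneg _) x
  have hveq : ({x | ‖u x‖ ≤ n}.indicator fun x => ENNReal.ofReal (youngCompl Ψ ‖u x‖))
      = fun x => ENNReal.ofReal (v x) := by
    funext x; by_cases hx : ‖u x‖ ≤ n <;> simp [hv, hx]
  rw [hveq]
  set h := condLExp 𝒜 μ fun x => ENNReal.ofReal (v x) with hh
  have hhm : Measurable[𝒜] h := measurable_condLExp 𝒜 μ _
  have hvle : ∀ x, v x ≤ youngCompl Ψ n := by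
    intro x
    by_cases hx : ‖u x‖ ≤ n
    · simpa [hv, hx] using hΨ.youngCompl_mono (by simpa using hx)
    · simpa [hv, hx] using hΨ.youngCompl_nonneg n
  have hfin : ∀ᵐ x ∂μ, h x < ∞ := by
    have h1 := condLExp_mono (mΩ := 𝒜) (P := μ) (X := fun x => ENNReal.ofReal (v x))
      (Y := fun _ => ENNReal.ofReal (youngCompl Ψ n))
      (Eventually.of_forall fun x => ENNReal.ofReal_le_ofReal (hvle x))
    rw [condLExp_const h𝒜] at h1
    filter_upwards [h1] with x hx using hx.trans_lt ENNReal.ofReal_lt_top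
  refine ae_of_forall_finite_measure h𝒜 fun A₀ hA₀ hμA₀ => ?_
  set A : Set Ω := A₀ ∩ {x | ENNReal.ofReal r ≤ h x} with hAdef
  have hA : MeasurableSet[𝒜] A :=
    MeasurableSet.inter hA₀ (measurableSet_le measurable_const hhm)
  have hμA : μ A < ∞ := (measure_mono Set.inter_subset_left).trans_lt hμA₀
  set φ : Ω → ℝ := A.indicator fun x => w * r / (h x).toReal with hφ
  have hφm : Measurable[𝒜] φ :=
    Measurable.indicator (m := 𝒜) (measurable_const.div hhm.ennreal_toReal) hA
  have hφ0 : ∀ x, 0 ≤ φ x := fun x => Set.indicator_nonneg (fun _ _ => by positivity) x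
  set f : Ω → ℂ := fun x => ((v x * φ x / ‖u x‖ ^ 2 : ℝ) : ℂ) * starRingEnd ℂ (u x) with hf
  have hfm : Measurable[mΩ] f :=
    (Complex.measurable_ofReal.comp ((hvm.mul (hφm.mono h𝒜 le_rfl)).div (hu.norm.pow_const 2))).mul
      (Complex.continuous_conj.measurable.comp hu)
  have hvu : ∀ x, u x = 0 → v x = 0 := fun x hx => by
    simp [hv, hx, hΨ.youngCompl_zero]
  have huf : (fun x => u x * f x) = fun x => ((φ x * v x : ℝ) : ℂ) := by
    funext x
    rcases eq_or_ne (u x) 0 with hx | hx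
    · simp [hx, hvu x hx]
    · have h2 : (‖u x‖ : ℂ) ≠ 0 := by simpa using hx
      simp only [hf]
      rw [mul_left_comm, Complex.mul_conj, Complex.normSq_eq_norm_sq]
      push_cast
      field_simp
  have hnf : ∀ x, ‖f x‖ = v x / ‖u x‖ * φ x := by
    intro x
    rcases eq_or_ne (u x) 0 with hx | hx
    · simp [hf, hx]
    · have h2 : ‖u x‖ ≠ 0 := by simpa using hx
      simp only [hf]
      rw [norm_mul, Complex.norm_conj, Complex.norm_real, Real.norm_of_nonneg
        (div_nonneg (mul_nonneg (hv0 x) (hφ0 x)) (sq_nonneg _))]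
      field_simp
  have hΨv : ∀ x, Ψ (v x / ‖u x‖) ≤ v x := by
    intro x
    rcases eq_or_ne (u x) 0 with hx | hx
    · simp [hx, hΨ.map_zero, hv0 x]
    · by_cases hxn : ‖u x‖ ≤ n
      · simpa [hv, hxn] using hΨ.map_youngCompl_div_le (norm_pos_iff.2 hx)
      · simp [hv, hxn, hΨ.map_zero]
  -- On `A` convexity gives `Ψ (w r / h) ≤ (r / h) Ψ w`, that is `c² h Ψ(φ) ≤ 1`.
  have hφh : ∀ᵐ x ∂μ, ENNReal.ofReal (c ^ 2 * Ψ (φ x)) * h x ≤ A.indicator 1 x := by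
    filter_upwards [hfin] with x hx
    by_cases hxA : x ∈ A
    · have hrh : r ≤ (h x).toReal := (ENNReal.ofReal_le_iff_le_toReal hx.ne).1 hxA.2
      have hh0 : 0 < (h x).toReal := hr0.trans_le hrh
      rw [← ENNReal.ofReal_toReal hx.ne, ← ENNReal.ofReal_mul
        (mul_nonneg (sq_nonneg c) (hΨ.nonneg _))]
      simp only [hxA, Set.indicator_of_mem, Pi.one_apply, ENNReal.ofReal_le_one, hφ]
      have h1 := hΨ.map_mul_le w (div_nonneg hr0.le hh0.le) ((div_le_one hh0).2 hrh)
      have e : w * r / (h x).toReal = r / (h x).toReal * w := by ring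
      have e2 : c ^ 2 * (r / (h x).toReal * Ψ w) * (h x).toReal = 1 := by
        rw [hr]; field_simp
      rw [e, ← e2]
      gcongr
    · simp [hxA, hφ, hΨ.map_zero]
  have hmod : ∀ t : ℝ, 0 ≤ t → ∫⁻ x, ENNReal.ofReal (Ψ (t * ‖f x‖)) ∂μ
      ≤ ∫⁻ x, ENNReal.ofReal (Ψ (t * ‖A.indicator (1 : Ω → ℂ) x‖)) ∂μ := by
    intro t ht
    rw [lintegral_young_indicator_one hΨ (h𝒜 A hA)]
    have hpt : ∀ x, Ψ (t * ‖f x‖) ≤ Ψ t * (c ^ 2 * Ψ (φ x) * v x) := by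
      intro x
      have hq : 0 ≤ v x / ‖u x‖ := div_nonneg (hv0 x) (norm_nonneg _)
      rw [hnf]
      calc Ψ (t * (v x / ‖u x‖ * φ x)) ≤ c * Ψ t * Ψ (v x / ‖u x‖ * φ x) :=
            hΔ _ _ ht (mul_nonneg hq (hφ0 x))
        _ ≤ c * Ψ t * (c * Ψ (v x / ‖u x‖) * Ψ (φ x)) :=
            mul_le_mul_of_nonneg_left (hΔ _ _ hq (hφ0 x)) (mul_nonneg hc.le (hΨ.nonneg _))
        _ ≤ c * Ψ t * (c * v x * Ψ (φ x)) := by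
            have := hΨ.nonneg t
            have := hΨ.nonneg (φ x)
            gcongr
            exact hΨv x
        _ = _ := by ring
    have hgm : Measurable[𝒜] fun x => ENNReal.ofReal (c ^ 2 * Ψ (φ x)) :=
      ((hΨ.continuous.measurable.comp hφm).const_mul _).ennreal_ofReal
    calc _ ≤ ∫⁻ x, ENNReal.ofReal (Ψ t) *
            (ENNReal.ofReal (c ^ 2 * Ψ (φ x)) * ENNReal.ofReal (v x)) ∂μ := by
          refine lintegral_mono fun x => ?_
          rw [← ENNReal.ofReal_mul (mul_nonneg (sq_nonneg c) (hΨ.nonneg _)),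
            ← ENNReal.ofReal_mul (hΨ.nonneg _)]
          exact ENNReal.ofReal_le_ofReal (hpt x)
      _ = ENNReal.ofReal (Ψ t) *
            ∫⁻ x, ENNReal.ofReal (c ^ 2 * Ψ (φ x)) * ENNReal.ofReal (v x) ∂μ :=
          lintegral_const_mul' _ _ ENNReal.ofReal_ne_top
      _ = ENNReal.ofReal (Ψ t) * ∫⁻ x, ENNReal.ofReal (c ^ 2 * Ψ (φ x)) * h x ∂μ := by
          rw [← lintegral_condLExp h𝒜,
            lintegral_congr_ae (condLExp_mul_left h𝒜 μ hgm hvm.ennreal_ofReal)]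
      _ ≤ ENNReal.ofReal (Ψ t) * ∫⁻ x, A.indicator 1 x ∂μ := by
          gcongr 1
          exact lintegral_mono_ae hφh
      _ = _ := by rw [lintegral_indicator_one₀ (h𝒜 A hA).nullMeasurableSet]
  have hfΨ : MemOrlicz Ψ μ f := ⟨hfm, 1, one_pos, (hmod 1 zero_le_one).trans_lt (by
    rw [lintegral_young_indicator_one hΨ (h𝒜 A hA)]
    exact ENNReal.mul_lt_top ENNReal.ofReal_lt_top hμA)⟩
  have hfA : luxemburgNorm Ψ μ f ≤ luxemburgNorm Ψ μ (A.indicator 1) := by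
    refine le_iInf₂ fun k hk => le_iInf fun hk1 => luxemburgNorm_le hk ?_
    simp only [div_eq_inv_mul _ k] at hk1 ⊢
    exact (hmod _ (by positivity)).trans hk1
  have h0 := measure_eq_zero_of_le_norm_wct hΨ h𝒜 hK hB hA hμA hfΨ hfA hwK (by
    filter_upwards [hfin, condLExp_mul_left h𝒜 μ hφm.ennreal_ofReal hvm.ennreal_ofReal]
      with x hx hx2 hxA
    have hrh : r ≤ (h x).toReal := (ENNReal.ofReal_le_iff_le_toReal hx.ne).1 hxA.2
    have hh0 : 0 < (h x).toReal := hr0.trans_le hrh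
    simp only [← ENNReal.ofReal_mul (hφ0 _)] at hx2
    rw [wct, huf, condExpComplex_ofReal h𝒜 μ (fun x => mul_nonneg (hφ0 x) (hv0 x)), hx2,
      Complex.norm_real, Real.norm_of_nonneg ENNReal.toReal_nonneg, ENNReal.toReal_mul,
      ENNReal.toReal_ofReal (hφ0 x)]
    simp only [hφ, hxA, Set.indicator_of_mem]
    exact (div_mul_cancel₀ _ hh0.ne').ge)
  filter_upwards [measure_eq_zero_iff_ae_notMem.1 h0] with x hx hxA
  by_contra! hlt
  exact hx ⟨hxA, hlt⟩

theorem condYoung_le_of_cutoff (h𝒜 : 𝒜 ≤ mΩ) [SigmaFinite (μ.trim h𝒜)] (hΨ : IsYoungFunction Ψ)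
    (hu : Measurable[mΩ] u) {r : ℝ≥0∞} (h : ∀ n : ℕ, ∀ᵐ x ∂μ,
      condLExp 𝒜 μ ({x | ‖u x‖ ≤ n}.indicator
        fun x => ENNReal.ofReal (youngCompl Ψ ‖u x‖)) x < r) :
    ∀ᵐ x ∂μ, condYoung 𝒜 μ (youngCompl Ψ) u x ≤ r := by
  refine ae_le_of_ae_le_trim (hm := h𝒜) (f₂ := fun _ => r) ?_
  refine ae_le_of_forall_setLIntegral_le_of_sigmaFinite (measurable_condLExp 𝒜 μ _) ?_
  intro s hs _
  rw [condYoung, setLIntegral_condLExp_trim h𝒜 _ _ hs, setLIntegral_const,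
    trim_measurableSet_eq h𝒜 hs]
  have hm : Measurable[mΩ] fun x => ENNReal.ofReal (youngCompl Ψ ‖u x‖) :=
    (hΨ.measurable_youngCompl_norm hu).ennreal_ofReal
  have hsup : ∀ x, ENNReal.ofReal (youngCompl Ψ ‖u x‖) = ⨆ n : ℕ,
      {x | ‖u x‖ ≤ n}.indicator (fun x => ENNReal.ofReal (youngCompl Ψ ‖u x‖)) x := by
    intro x
    refine le_antisymm ?_ (iSup_le fun n => Set.indicator_le_self _ _ x)
    obtain ⟨n, hn⟩ := exists_nat_ge ‖u x‖
    refine le_iSup_of_le n ?_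
    rw [Set.indicator_of_mem (by exact hn)]
  rw [lintegral_congr hsup, lintegral_iSup fun n =>
     hm.indicator (measurableSet_le hu.norm measurable_const)]
  · refine iSup_le fun n => ?_
    rw [← setLIntegral_condLExp h𝒜 μ _ hs, ← setLIntegral_const]
    exact lintegral_mono_ae (ae_restrict_of_ae ((h n).mono fun x hx => hx.le))
  · intro m n hmn x
    refine Set.indicator_le_indicator_of_subset (fun y (hy : ‖u y‖ ≤ m) => ?_)
      (fun _ => zero_le) x
    exact hy.trans (by exact_mod_cast hmn)

theorem memLp_wctSymbol_of_condYoung_le (h𝒜 : 𝒜 ≤ mΩ) (hΨ : IsYoungFunction Ψ) {r : ℝ≥0∞}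
    (hr : r ≠ ∞) (h : ∀ᵐ x ∂μ, condYoung 𝒜 μ (youngCompl Ψ) u x ≤ r) :
    MemLp (wctSymbol 𝒜 μ Ψ u) ∞ (μ.trim h𝒜) := by
  have hm : Measurable[𝒜] (wctSymbol 𝒜 μ Ψ u) := measurable_wctSymbol μ Ψ u
  refine ⟨hm.aestronglyMeasurable, ?_⟩
  rw [eLpNorm_exponent_top]
  refine (essSup_le_of_ae_le (youngInv (youngCompl Ψ) r) ?_).trans_lt
    (youngInv_lt_top hΨ.tendsto_youngCompl hr)
  have : ∀ᵐ x ∂μ, wctSymbol 𝒜 μ Ψ u x ≤ youngInv (youngCompl Ψ) r :=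
    h.mono fun x hx => youngInv_mono _ hx
  rw [ae_iff] at this
  change ∀ᵐ x ∂(μ.trim h𝒜), wctSymbol 𝒜 μ Ψ u x ≤ youngInv (youngCompl Ψ) r
  rw [ae_iff, trim_measurableSet_eq h𝒜]
  · exact this
  · exact (measurableSet_le hm measurable_const).compl

/-! ### Sufficient conditions for boundedness -/

theorem wctSymbol_le_eLpNorm (h𝒜 : 𝒜 ≤ mΩ) :
    ∀ᵐ x ∂μ, wctSymbol 𝒜 μ Ψ u x ≤ eLpNorm (wctSymbol 𝒜 μ Ψ u) ∞ (μ.trim h𝒜) := by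
  refine ae_of_ae_trim h𝒜 ?_
  rw [eLpNorm_exponent_top]
  exact ae_le_eLpNormEssSup

/-- The `GCH`-inequality for `f` and `u`. As `u` need not belong to `L^{Ψ*}`, it is applied to the
restrictions of `u` to `𝒜`-measurable sets of finite measure. -/
theorem GCHWith.condLExp_enorm_mul_le (h𝒜 : 𝒜 ≤ mΩ) [SigmaFinite (μ.trim h𝒜)]
    (hΨ : IsYoungFunction Ψ) (hu : Measurable[mΩ] u) {C : ℝ} (hC : GCHWith 𝒜 μ Ψ C) {S : ℝ≥0}
    (hS : ∀ᵐ x ∂μ, wctSymbol 𝒜 μ Ψ u x ≤ S) {f : Ω → ℂ} (hf : MemOrlicz Ψ μ f) :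
    ∀ᵐ x ∂μ, condLExp 𝒜 μ (fun y => ‖u y * f y‖ₑ) x
      ≤ ENNReal.ofReal C * youngInv Ψ (condYoung 𝒜 μ Ψ f x) * S := by
  have hum : Measurable[mΩ] fun x => ENNReal.ofReal (youngCompl Ψ ‖u x‖) :=
    (hΨ.measurable_youngCompl_norm hu).ennreal_ofReal
  refine ae_of_forall_finite_measure h𝒜 fun A hA hμA => ?_
  have hind : Measurable[𝒜] (A.indicator (1 : Ω → ℝ≥0∞)) :=
    measurable_indicator_one hA
  have e : ∀ x, ENNReal.ofReal (youngCompl Ψ ‖A.indicator u x‖)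
      = A.indicator 1 x * ENNReal.ofReal (youngCompl Ψ ‖u x‖) := fun x => by
    by_cases hx : x ∈ A <;> simp [hx, hΨ.youngCompl_zero]
  have hmem : MemOrlicz (youngCompl Ψ) μ (A.indicator u) := by
    refine ⟨hu.indicator (h𝒜 A hA), 1, one_pos, ?_⟩
    simp only [one_mul, e]
    rw [← lintegral_condLExp h𝒜, lintegral_congr_ae (condLExp_mul_left h𝒜 μ hind hum)]
    calc _ ≤ ∫⁻ x, A.indicator 1 x * ENNReal.ofReal (youngCompl Ψ ((S + 1 : ℝ≥0) : ℝ)) ∂μ := by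
          refine lintegral_mono_ae ?_
          filter_upwards [hS] with x hx
          gcongr
          refine le_ofReal_of_youngInv_lt (lt_of_le_of_lt hx ?_)
          exact ENNReal.coe_lt_coe.2 (lt_add_one S)
      _ = μ A * ENNReal.ofReal (youngCompl Ψ ((S + 1 : ℝ≥0) : ℝ)) := by
          rw [lintegral_mul_const' _ _ ENNReal.ofReal_ne_top,
            lintegral_indicator_one₀ (h𝒜 A hA).nullMeasurableSet]
      _ < ∞ := ENNReal.mul_lt_top hμA ENNReal.ofReal_lt_top
  have e2 : (fun y => ‖f y * A.indicator u y‖ₑ) = fun y => A.indicator 1 y * ‖u y * f y‖ₑ := by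
    funext y; by_cases hy : y ∈ A <;> simp [hy, mul_comm]
  have h1 := hC f _ hf hmem
  rw [e2] at h1
  have h3 := condLExp_mul_left h𝒜 μ hind hum
  filter_upwards [h1, h3, condLExp_mul_left h𝒜 μ hind (hu.mul hf.1).enorm, hS]
    with x hx1 hx3 hx2 hxS hxA
  simp only [condYoung, e] at hx1
  simp only [Pi.mul_apply] at hx2
  rw [hx2, hx3] at hx1
  simp only [hxA, Set.indicator_of_mem, Pi.one_apply, one_mul] at hx1
  exact hx1.trans (mul_le_mul' le_rfl hxS)

/-- If `∫ Ψ(|f| / k) ≤ 1`, then `R_u f` is conditionable and `∫ Ψ(|R_u f| / (k L)) ≤ 1` for all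
`L > 0` with `L ≥ C S`. -/
theorem GCHWith.lintegral_wct_le_one (h𝒜 : 𝒜 ≤ mΩ) [SigmaFinite (μ.trim h𝒜)]
    (hΨ : IsYoungFunction Ψ) (hu : Measurable[mΩ] u) {C : ℝ} (hC : GCHWith 𝒜 μ Ψ C) {S : ℝ≥0}
    (hS : ∀ᵐ x ∂μ, wctSymbol 𝒜 μ Ψ u x ≤ S) {f : Ω → ℂ} (hf : Measurable[mΩ] f) {k : ℝ}
    (hk : 0 < k) (hk1 : ∫⁻ x, ENNReal.ofReal (Ψ (‖f x‖ / k)) ∂μ ≤ 1) :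
    Conditionable 𝒜 μ (fun x => u x * f x) ∧
      ∀ L : ℝ, 0 < L → ENNReal.ofReal C * S ≤ ENNReal.ofReal L →
        ∫⁻ x, ENNReal.ofReal (Ψ (‖wct 𝒜 μ u f x‖ / (k * L))) ∂μ ≤ 1 := by
  set F : Ω → ℂ := fun x => ((k⁻¹ : ℝ) : ℂ) * f x with hF
  have hnF : ∀ x, ‖F x‖ = ‖f x‖ / k := fun x => by
    rw [hF, norm_mul, Complex.norm_real, Real.norm_of_nonneg (by positivity), div_eq_inv_mul]
  have hFm : Measurable[mΩ] F := hf.const_mul _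
  have hFΨ : MemOrlicz Ψ μ F := ⟨hFm, 1, one_pos, by
    simp only [hnF, one_mul]; exact hk1.trans_lt ENNReal.one_lt_top⟩
  have hint : ∫⁻ x, condYoung 𝒜 μ Ψ F x ∂μ ≤ 1 := by
    simp only [condYoung, lintegral_condLExp h𝒜, hnF]; exact hk1
  have hYfin : ∀ᵐ x ∂μ, condYoung 𝒜 μ Ψ F x < ∞ :=
    condLExp_lt_top (by simp only [hnF]; exact (hk1.trans_lt ENNReal.one_lt_top).ne)
  have hmain := hC.condLExp_enorm_mul_le h𝒜 hΨ hu hS hFΨ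
  have hpull := condLExp_mul_left h𝒜 μ (g := fun _ => ENNReal.ofReal k⁻¹)
    (@measurable_const _ _ _ 𝒜 _) (hu.mul hf).enorm
  have e : (fun y => ‖u y * F y‖ₑ) = fun y => ENNReal.ofReal k⁻¹ * ‖u y * f y‖ₑ := by
    funext y
    simp only [hF]
    rw [mul_left_comm, enorm_mul, ← ofReal_norm, Complex.norm_real,
      Real.norm_of_nonneg (by positivity)]
  rw [e] at hmain
  have hk0 : 0 < k⁻¹ := inv_pos.2 hk
  have hcond : Conditionable 𝒜 μ (fun x => u x * f x) := by
    refine ⟨hu.mul hf, ?_⟩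
    filter_upwards [hmain, hpull, hYfin] with x h1 h2 h3
    simp only [Pi.mul_apply] at h2
    rw [h2] at h1
    have h4 := youngInv_lt_top hΨ.tendsto_atTop h3.ne
    have h5 := h1.trans_lt (ENNReal.mul_lt_top (ENNReal.mul_lt_top ENNReal.ofReal_lt_top h4)
      ENNReal.coe_lt_top)
    exact ENNReal.lt_top_of_mul_ne_top_right h5.ne (ENNReal.ofReal_pos.2 hk0).ne'
  refine ⟨hcond, fun L hL hCL => (lintegral_mono_ae ?_).trans hint⟩
  filter_upwards [hmain, hpull, hcond.2, norm_condExpComplex_le h𝒜 μ hcond] with x h1 h2 h3 h4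
  simp only [Pi.mul_apply] at h2
  rw [h2] at h1
  set e₀ := condLExp 𝒜 μ (fun y => ‖u y * f y‖ₑ) x with he₀
  have h6 : ENNReal.ofReal (‖wct 𝒜 μ u f x‖ / k) ≤ ENNReal.ofReal L *
      youngInv Ψ (condYoung 𝒜 μ Ψ F x) := by
    calc ENNReal.ofReal (‖wct 𝒜 μ u f x‖ / k) ≤ ENNReal.ofReal k⁻¹ * e₀ := by
          rw [div_eq_inv_mul, ENNReal.ofReal_mul hk0.le]
          gcongr
          exact ENNReal.ofReal_le_of_le_toReal h4
      _ ≤ _ := h1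
      _ = ENNReal.ofReal C * S * youngInv Ψ (condYoung 𝒜 μ Ψ F x) := by ring
      _ ≤ _ := by gcongr
  have h7 : ((‖wct 𝒜 μ u f x‖ / (k * L)).toNNReal : ℝ≥0∞)
      ≤ youngInv Ψ (condYoung 𝒜 μ Ψ F x) := by
    change ENNReal.ofReal _ ≤ _
    rw [← div_div, ENNReal.ofReal_div_of_pos hL]
    exact ENNReal.div_le_of_le_mul' h6
  have h8 := hΨ.ofReal_le_of_le_youngInv h7
  rwa [Real.coe_toNNReal _ (by positivity)] at h8

theorem GCHWith.luxemburgNorm_wct_le (h𝒜 : 𝒜 ≤ mΩ) [SigmaFinite (μ.trim h𝒜)]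
    (hΨ : IsYoungFunction Ψ) (hu : Measurable[mΩ] u) {C : ℝ} (hC : GCHWith 𝒜 μ Ψ C) {S : ℝ≥0}
    (hS : ∀ᵐ x ∂μ, wctSymbol 𝒜 μ Ψ u x ≤ S) {f : Ω → ℂ} (hf : MemOrlicz Ψ μ f) :
    luxemburgNorm Ψ μ (wct 𝒜 μ u f) ≤ ENNReal.ofReal C * S * luxemburgNorm Ψ μ f := by
  refine hf.le_mul_luxemburgNorm hΨ (by finiteness) fun k hk hk1 => ?_
  have h := (hC.lintegral_wct_le_one h𝒜 hΨ hu hS hf.1 hk hk1).2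
  -- `C S` may vanish, so the bound is obtained as a limit of bounds by `k L` with `L > C S`.
  have hkt : ENNReal.ofReal k ≠ 0 := (ENNReal.ofReal_pos.2 hk).ne'
  rw [← ENNReal.div_le_iff hkt ENNReal.ofReal_ne_top]
  refine le_of_forall_gt_imp_ge_of_dense fun L hL => ?_
  rw [ENNReal.div_le_iff hkt ENNReal.ofReal_ne_top]
  rcases eq_or_ne L ∞ with rfl | hLt
  · rw [ENNReal.top_mul hkt]; exact le_top
  have hL0 : 0 < L.toReal := ENNReal.toReal_pos (lt_of_le_of_lt zero_le hL).ne' hLt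
  refine (luxemburgNorm_le (by positivity) (h L.toReal hL0 ?_)).trans ?_
  · rw [ENNReal.ofReal_toReal hLt]; exact hL.le
  · rw [ENNReal.ofReal_mul hk.le, ENNReal.ofReal_toReal hLt, mul_comm]

theorem GCHWith.wctWellDefined (h𝒜 : 𝒜 ≤ mΩ) [SigmaFinite (μ.trim h𝒜)]
    (hΨ : IsYoungFunction Ψ) (hu : Measurable[mΩ] u) {C : ℝ} (hC : GCHWith 𝒜 μ Ψ C) {S : ℝ≥0}
    (hS : ∀ᵐ x ∂μ, wctSymbol 𝒜 μ Ψ u x ≤ S) : WCTWellDefined 𝒜 μ Ψ Ψ u := by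
  intro f hf
  obtain ⟨k, hk, hk1⟩ := hf.exists_lintegral_le_one hΨ
  obtain ⟨h1, h2⟩ := hC.lintegral_wct_le_one h𝒜 hΨ hu hS hf.1 hk hk1
  refine ⟨h1, (measurable_condExpComplex μ _).mono h𝒜 le_rfl, ?_⟩
  have hL : 0 < (ENNReal.ofReal C * S).toReal + 1 := by positivity
  have h3 := h2 _ hL (by
    rw [ENNReal.ofReal_add ENNReal.toReal_nonneg zero_le_one,
      ENNReal.ofReal_toReal (by finiteness)]
    exact le_self_add)
  refine ⟨(k * ((ENNReal.ofReal C * S).toReal + 1))⁻¹, by positivity, ?_⟩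
  simp only [← div_eq_inv_mul]
  exact h3.trans_lt ENNReal.one_lt_top

theorem GCHWith.luxemburgNorm_wct_le_of_dom (h𝒜 : 𝒜 ≤ mΩ) [SigmaFinite (μ.trim h𝒜)]
    (hΦ : IsYoungFunction Φ) (hΨ : IsYoungFunction Ψ) (hu : Measurable[mΩ] u) {C : ℝ}
    (hC : GCHWith 𝒜 μ Ψ C) (hS : MemLp (wctSymbol 𝒜 μ Ψ u) ∞ (μ.trim h𝒜)) {a T : ℝ}
    (hdom : YoungDomWith Ψ Φ a T) (hN : ENNReal.ofReal (Ψ T) * μ Set.univ < ∞) {f : Ω → ℂ}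
    (hf : MemOrlicz Φ μ f) :
    luxemburgNorm Ψ μ (wct 𝒜 μ u f) ≤
      ENNReal.ofReal (a * C) * (ENNReal.ofReal (Ψ T) * μ Set.univ + 1)
        * eLpNorm (wctSymbol 𝒜 μ Ψ u) ∞ (μ.trim h𝒜) * luxemburgNorm Φ μ f := by
  have hS' := wctSymbol_le_eLpNorm (μ := μ) (Ψ := Ψ) (u := u) h𝒜
  obtain ⟨S, hSe⟩ : ∃ S : ℝ≥0, (S : ℝ≥0∞) = eLpNorm (wctSymbol 𝒜 μ Ψ u) ∞ (μ.trim h𝒜) :=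
    ⟨_, ENNReal.coe_toNNReal hS.2.ne⟩
  rw [← hSe] at hS' ⊢
  have h1 := hC.luxemburgNorm_wct_le h𝒜 hΨ hu hS' (hdom.memOrlicz hΨ hΦ hN hf)
  have h2 := hdom.luxemburgNorm_le hΨ hΦ hN hf
  calc _ ≤ _ := h1
    _ ≤ ENNReal.ofReal C * S * (ENNReal.ofReal a * (ENNReal.ofReal (Ψ T) * μ Set.univ + 1)
          * luxemburgNorm Φ μ f) := by gcongr
    _ = _ := by rw [ENNReal.ofReal_mul hdom.1]; ring

end Operator

/-! ### Boundedness of weighted conditional type operators -/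

theorem theorem2p2 {Ω : Type*} {𝒜 mΩ : MeasurableSpace Ω} (h𝒜 : 𝒜 ≤ mΩ)
    (μ : Measure[mΩ] Ω) [SigmaFinite μ] [SigmaFinite (μ.trim h𝒜)]
    (Φ Ψ : ℝ → ℝ) (hΦ : IsYoungFunction Φ) (hΨ : IsYoungFunction Ψ)
    (u : Ω → ℂ) (hu : Measurable[mΩ] u) :
    -- (a) necessary conditions
    (YoungDomFor μ Φ Ψ → WCTBounded 𝒜 μ Φ Ψ u →
      (Conditionable 𝒜 μ u ∧ MemLp (condExpComplex 𝒜 μ u) ∞ (μ.trim h𝒜)) ∧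
      (IsYoungFunction (youngCompl Ψ) → DeltaPrimeGlobally Ψ →
        MemLp (wctSymbol 𝒜 μ Ψ u) ∞ (μ.trim h𝒜))) ∧
    -- (b) sufficient conditions, with the bounds for the operator norm
    (YoungDomFor μ Ψ Φ → GCH 𝒜 μ Ψ → MemLp (wctSymbol 𝒜 μ Ψ u) ∞ (μ.trim h𝒜) →
      WCTBounded 𝒜 μ Φ Ψ u ∧
      (∀ C a : ℝ, 0 < C → GCHWith 𝒜 μ Ψ C → μ Set.univ = ∞ → YoungDomWith Ψ Φ a 0 →
        wctOpNorm 𝒜 μ Φ Ψ u ≤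
          ENNReal.ofReal (a * C) * eLpNorm (wctSymbol 𝒜 μ Ψ u) ∞ (μ.trim h𝒜)) ∧
      (∀ C a T : ℝ, 0 < C → GCHWith 𝒜 μ Ψ C → μ Set.univ < ∞ → YoungDomWith Ψ Φ a T →
        wctOpNorm 𝒜 μ Φ Ψ u ≤
          ENNReal.ofReal (a * C) * (ENNReal.ofReal (Ψ T) * μ Set.univ + 1)
            * eLpNorm (wctSymbol 𝒜 μ Ψ u) ∞ (μ.trim h𝒜))) := by
  constructor
  · rintro hdom ⟨hwd, K, hK⟩
    obtain ⟨a, T, hD, hN⟩ := hdom.exists_domWith hΦ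
    obtain ⟨B, hBe⟩ : ∃ B : ℝ≥0, (B : ℝ≥0∞)
        = ENNReal.ofReal a * (ENNReal.ofReal (Φ T) * μ Set.univ + 1) :=
      ⟨_, ENNReal.coe_toNNReal (by finiteness)⟩
    have hB : ∀ f, MemOrlicz Ψ μ f →
        MemOrlicz Φ μ f ∧ luxemburgNorm Φ μ f ≤ B * luxemburgNorm Ψ μ f := fun f hf =>
      ⟨hD.memOrlicz hΦ hΨ hN hf, hBe ▸ hD.luxemburgNorm_le hΦ hΨ hN hf⟩
    refine ⟨⟨conditionable_of_wellDefined hΦ h𝒜 hu hwd, memLp_condExpComplex hΨ h𝒜 hu hK hB⟩, ?_⟩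
    rintro hΨ' ⟨c, hc, hΔ⟩
    obtain ⟨w, hw, hwlt⟩ := hΨ.exists_lt_mul_of_youngCompl hΨ'
      (ε := 1 / (c ^ 2 * (K * B + 1))) (by positivity)
    have hΨw := hΨ.pos hw.ne'
    have hwK : (K * B : ℝ) < w * (1 / (c ^ 2 * Ψ w)) := by
      rw [one_div_mul_eq_div, lt_div_iff₀ (by positivity)] at hwlt
      rw [mul_one_div, lt_div_iff₀ (by positivity)]
      nlinarith [mul_pos (pow_pos hc 2) hΨw]
    exact memLp_wctSymbol_of_condYoung_le h𝒜 hΨ ENNReal.ofReal_ne_top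
      (condYoung_le_of_cutoff h𝒜 hΨ hu
        (condLExp_cutoff_lt hΨ h𝒜 hu hK hB hc hΔ hw hwK))
  · intro hdom hGCH hS
    refine ⟨?_, fun C a hC hG hμ hD => sInf_le fun f hf => ?_,
      fun C a T hC hG hμ hD => sInf_le fun f hf => ?_⟩
    · obtain ⟨C, -, hG⟩ := hGCH
      obtain ⟨a, T, hD, hN⟩ := hdom.exists_domWith hΨ
      obtain ⟨S, hSe⟩ : ∃ S : ℝ≥0, (S : ℝ≥0∞) = eLpNorm (wctSymbol 𝒜 μ Ψ u) ∞ (μ.trim h𝒜) :=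
        ⟨_, ENNReal.coe_toNNReal hS.2.ne⟩
      have hS' := wctSymbol_le_eLpNorm (μ := μ) (Ψ := Ψ) (u := u) h𝒜
      rw [← hSe] at hS'
      refine ⟨fun f hf => hG.wctWellDefined h𝒜 hΨ hu hS' f (hD.memOrlicz hΨ hΦ hN hf),
        (ENNReal.ofReal (a * C) * (ENNReal.ofReal (Ψ T) * μ Set.univ + 1) * S).toNNReal,
        fun f hf => ?_⟩
      rw [ENNReal.coe_toNNReal (by finiteness), hSe]
      exact hG.luxemburgNorm_wct_le_of_dom h𝒜 hΦ hΨ hu hS hD hN hf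
    · have h := hG.luxemburgNorm_wct_le_of_dom h𝒜 hΦ hΨ hu hS hD
        (by simp [hΨ.map_zero]) hf
      simpa [hΨ.map_zero] using h
    · exact hG.luxemburgNorm_wct_le_of_dom h𝒜 hΦ hΨ hu hS hD
        (ENNReal.mul_lt_top ENNReal.ofReal_lt_top hμ) hf
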